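/- Let $X:\Sigma\to\mathbb{R}^3$ be a smoothly immersed connected minimal surface with smooth unit normal $\mathbf{n}$ and Gauss curvature $\mathcal{K}<0$, and let $\mathbf{V}_1\neq\mathbf{V}_2$ be constant unit vectors in $\mathbb{R}^3$. Write $\mathbf{n}_{\mathbf{V}}=\langle\mathbf{n},\mathbf{V}\rangle$. Suppose that the Chern--Ricci function $$\sum_{\mathbf{V}\in\{\mathbf{V}_1,-\mathbf{V}_1,\mathbf{V}_2,-\mathbf{V}_2\}}\ln\frac{(1-\mathbf{n}_{\mathbf{V}})^2}{\sqrt{-\mathcal{K}}}$$ is constant (on the set of points of $\Sigma$ at which it is defined, that is, where $\mathbf{n}\notin\{\pm\mathbf{V}_1,\pm\mathbf{V}_2\}$). Let $\theta\in(0,\pi/2]$ be half the angle between $\mathbf{V}_1$ and $\mathbf{V}_2$, so that $\langle\mathbf{V}_1,\mathbf{V}_2\rangle=\cos 2\theta$. Then there are $\rho>0$, $\Theta\in[0,2\pi]$ and an orientation-preserving rigid motion of $\mathbb{R}^3$ which takes the surface to (a part of) the minimal surface $\Sigma_{\theta,\rho,\Theta}$ with Weierstrass data $(\mathbf{G},d\mathbf{h})$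 given by $$\frac{1}{\mathbf{G}}\,d\mathbf{h}=\frac{\rho\,e^{i\Theta}}{(\mathbf{G}^2-e^{2i\theta})(\mathbf{G}^2-e^{-2i\theta})}\,d\mathbf{G}.$$ Explicitly, after the rigid motion the Gauss map $\mathbf{G}$ (the stereographic projection of the unit normal from the north pole) omits $\pm e^{i\theta},\pm e^{-i\theta}$, and $$dX=\mathrm{Re}\left(\tfrac12\left(\tfrac1{\mathbf{G}}-\mathbf{G}\right)d\mathbf{h},\ \tfrac i2\left(\tfrac1{\mathbf{G}}+\mathbf{G}\right)d\mathbf{h},\ d\mathbf{h}\right)$$ (extended to the points with $\mathbf{G}\in\{0,\infty\}$); moreover each point of the surface, together with its normal, is obtained by integrating these data along a path from $\mathbf{G}=0$, with initial position the origin, in the Riemann sphere punctured at $\pm e^{i\theta},\pm e^{-i\theta}$, i.e. it lies on $\Sigma_{\theta,\rho,\Theta}$. If $\mathbf{V}_2\neq-\mathbf{V}_1$, then $0<\theta<\pi/2$, and for fixed $\theta$ and $\rho$ the surfaces $\Sigma_{\theta,\rho,\Theta}$ are by definition the associate family of the generalized Scherk surfaces, which connects the generalized singly periodic Scherk tower ($\Theta=0$)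 and the generalized doubly periodic Scherk surface ($\Theta=\pi/2$). If $\mathbf{V}_2=-\mathbf{V}_1$, then $\theta=\pi/2$ and the data are $d\mathbf{h}/\mathbf{G}=\rho e^{i\Theta}\,d\mathbf{G}/(\mathbf{G}^2+1)^2$, those of the associate family of the catenoid. -/

import Mathlib

open scoped Manifold ContDiff

noncomputable section

namespace Scherk

/-- Euclidean three-space. -/
abbrev E3 : Type := EuclideanSpace ℝ (Fin 3)

section Surface

variable {M : Type*} [TopologicalSpace M] [ChartedSpace (EuclideanSpace ℝ (Fin 2)) M]

/-- The differential at `p` of a map from a surface to a real normed space `F`; the tangent plane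
at `p` is identified with `ℝ²` by the preferred chart at `p`. -/
def diff {F : Type*} [NormedAddCommGroup F] [NormedSpace ℝ F] (f : M → F) (p : M) :
    EuclideanSpace ℝ (Fin 2) →L[ℝ] F :=
  mfderiv (𝓡 2) 𝓘(ℝ, F) f p

/-- The first fundamental form `⟨X_i, X_j⟩` of `X`, in the preferred chart at `p`. -/
def firstForm (X : M → E3) (p : M) : Matrix (Fin 2) (Fin 2) ℝ :=
  Matrix.of fun i j =>
    inner ℝ (diff X p (EuclideanSpace.single i 1)) (diff X p (EuclideanSpace.single j 1))

/-- The second fundamental form `-⟨X_i, n_j⟩` of `X` with respect to the unit normal `n`, in the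
preferred chart at `p`. -/
def secondForm (X n : M → E3) (p : M) : Matrix (Fin 2) (Fin 2) ℝ :=
  Matrix.of fun i j =>
    -inner ℝ (diff X p (EuclideanSpace.single i 1)) (diff n p (EuclideanSpace.single j 1))

/-- The matrix of the shape operator in the preferred chart at `p`. -/
def shapeOperator (X n : M → E3) (p : M) : Matrix (Fin 2) (Fin 2) ℝ :=
  (firstForm X p)⁻¹ * secondForm X n p

/-- The Gauss curvature: the product of the principal curvatures. -/
def gaussCurvature (X n : M → E3) (p : M) : ℝ :=
  (shapeOperator X n p).det

/-- The mean curvature: the mean of the principal curvatures. -/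
def meanCurvature (X n : M → E3) (p : M) : ℝ :=
  (shapeOperator X n p).trace / 2

/-- `X` is a smoothly immersed minimal surface with smooth unit normal field `n`. -/
structure IsMinimalSurface (X n : M → E3) : Prop where
  smooth : ContMDiff (𝓡 2) 𝓘(ℝ, E3) ∞ X
  immersion : ∀ p, Function.Injective (diff X p)
  smooth_normal : ContMDiff (𝓡 2) 𝓘(ℝ, E3) ∞ n
  norm_normal : ∀ p, ‖n p‖ = 1
  normal : ∀ p v, inner ℝ (n p) (diff X p v) = 0
  minimal : ∀ p, meanCurvature X n p = 0

open Classical in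
/-- The set `{V₁, -V₁, V₂, -V₂}`. -/
def directions (V₁ V₂ : E3) : Finset E3 := {V₁, -V₁, V₂, -V₂}

/-- The Chern-Ricci function `∑ ln ((1 - n_V)² / √(-K))`, summed over `V ∈ {V₁, -V₁, V₂, -V₂}`.
It is meaningful at the points where `K < 0` and `n_V < 1` for each of these `V`. -/
def chernRicci (X n : M → E3) (V₁ V₂ : E3) (p : M) : ℝ :=
  ∑ V ∈ directions V₁ V₂,
    Real.log ((1 - inner ℝ (n p) V) ^ 2 / Real.sqrt (-gaussCurvature X n p))

/-- The value at `p` of the complex Gauss map `G`: the stereographic projection of `n p` from the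
north pole `(0, 0, 1)`. It is finite if `n p` is not the north pole. -/
def gaussMap (n : M → E3) (p : M) : ℂ :=
  ((n p 0 : ℂ) + Complex.I * (n p 1 : ℂ)) / (1 - (n p 2 : ℂ))

/-- The value at `p` of `1 / G`. It is finite if `n p` is not the south pole. -/
def invGaussMap (n : M → E3) (p : M) : ℂ :=
  ((n p 0 : ℂ) - Complex.I * (n p 1 : ℂ)) / (1 + (n p 2 : ℂ))

end Surface

/-- The quartic `(G² - e^{2iθ}) (G² - e^{-2iθ})`, homogenized by `G = a / b`. -/
def quartic (θ : ℝ) (a b : ℂ) : ℂ :=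
  (a ^ 2 - Complex.exp (2 * Complex.I * θ) * b ^ 2) *
    (a ^ 2 - Complex.exp (-(2 * Complex.I * θ)) * b ^ 2)

/-- The Enneper-Weierstrass integrand
`Re ( (1/2) (1/G - G) dh, (i/2) (1/G + G) dh, dh )` for the data
`dh / G = ρ e^{iΘ} dG / ((G² - e^{2iθ}) (G² - e^{-2iθ}))`,
written in homogeneous coordinates `G = a / b`, so that it also makes sense at `G = ∞`
(where `b = 0`): here `da` and `db` are the differentials of `a` and `b`, so that
`b² dG = b da - a db`. For `b = 1`, `db = 0` this is, with `η = dh / G`,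
`Re ( (1/2) (1 - G²) η, (i/2) (1 + G²) η, G η )`. -/
def scherkForm (θ ρ Θ : ℝ) (a b da db : ℂ) : E3 :=
  let η : ℂ := ρ * Complex.exp (Complex.I * Θ) * (b * da - a * db) / quartic θ a b
  !₂[((b ^ 2 - a ^ 2) / 2 * η).re, (Complex.I / 2 * (b ^ 2 + a ^ 2) * η).re, (a * b * η).re]

/-- The point of the unit sphere whose stereographic projection from the north pole is
`a / b` (the north pole itself if `b = 0`). -/
def spherePoint (a b : ℂ) : E3 :=
  (‖a‖ ^ 2 + ‖b‖ ^ 2)⁻¹ •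
    !₂[2 * (a * starRingEnd ℂ b).re, 2 * (a * starRingEnd ℂ b).im, ‖a‖ ^ 2 - ‖b‖ ^ 2]

/-- The surface `Y` with unit normal `N` has the Weierstrass data `(G, dh)` with
`dh / G = ρ e^{iΘ} dG / ((G² - e^{2iθ}) (G² - e^{-2iθ}))`: the Gauss map `G` (the stereographic
projection of `N`) omits the four poles, and `dY` is the Enneper-Weierstrass form of these data,
expressed by `G` where `G` is finite and by `1 / G` where `G` does not vanish. -/
structure HasScherkData {M : Type*} [TopologicalSpace M]
    [ChartedSpace (EuclideanSpace ℝ (Fin 2)) M] (θ ρ Θ : ℝ) (Y N : M → E3) : Prop where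
  omits : ∀ p, N p 2 ≠ 1 → quartic θ (gaussMap N p) 1 ≠ 0
  finite : ∀ p, N p 2 ≠ 1 → ∀ v,
    diff Y p v = scherkForm θ ρ Θ (gaussMap N p) 1 (diff (gaussMap N) p v) 0
  infinite : ∀ p, N p 2 ≠ -1 → ∀ v,
    diff Y p v = scherkForm θ ρ Θ 1 (invGaussMap N p) 0 (diff (invGaussMap N) p v)

/-- The maximal surface with the Weierstrass data
`dh / G = ρ e^{iΘ} dG / ((G² - e^{2iθ}) (G² - e^{-2iθ}))`, as the set of pairs
(position, unit normal): all that is reached from the origin, with normal the south pole (`G = 0`),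
by integrating the data along a path `G = a / b` on the Riemann sphere minus the four poles
`±e^{iθ}`, `±e^{-iθ}`; the path is continuous, and differentiable off a finite set.
For fixed `0 < θ < π / 2` and `ρ` these surfaces are the associate family of the generalized
Scherk surfaces: `Θ = 0` is the generalized singly periodic Scherk tower, `Θ = π / 2` is the
generalized doubly periodic Scherk surface. -/
def scherkSurface (θ ρ Θ : ℝ) : Set (E3 × E3) :=
  {q | ∃ (a b : ℝ → ℂ) (y : ℝ → E3) (s : Finset ℝ),
    ContinuousOn a (Set.Icc 0 1) ∧ ContinuousOn b (Set.Icc 0 1) ∧ ContinuousOn y (Set.Icc 0 1) ∧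
    (∀ t ∈ Set.Icc (0 : ℝ) 1, quartic θ (a t) (b t) ≠ 0) ∧
    (∀ t ∈ Set.Ioo (0 : ℝ) 1, t ∉ s → DifferentiableAt ℝ a t ∧ DifferentiableAt ℝ b t ∧
      HasDerivAt y (scherkForm θ ρ Θ (a t) (b t) (deriv a t) (deriv b t)) t) ∧
    a 0 = 0 ∧ y 0 = 0 ∧ q = (y 1, spherePoint (a 1) (b 1))}

end Scherk

end

/-! Let `g` be the stereographic projection of the normal. A tangent vector at a point with finite
`g` is `nullForm g η` for a unique complex `η`, and in this coordinate the differential of the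
normal is a positive multiple of the conjugate of `dg`. Symmetry and vanishing trace of the shape
operator then say exactly that the coordinate of `dX` is complex proportional to `dg`, so `dX =
nullForm g (F dg)` without any choice of conformal coordinates (`exists_weierstrass`). The same
computation gives `|F|² (1 + |g|²)⁴ (-K) = 16`.

Pairing `V` with `-V`, constancy of the Chern-Ricci function becomes `(1 - n_{V₁}²)(1 - n_{V₂}²) = c
(-K)` (`exists_curvature_eq`). Rotate `V₁`, `V₂` to the equator at the angles `±θ`
(`exists_rotation`) and let `Q = quartic θ g 1`. Then `|Q|²` is `(1 + |g|²)⁴` times the left side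
(`normSq_quartic`), whence `|F Q|² = 16 c` wherever `Q ≠ 0`. Since `dX` is closed, `dF ∧ dg = 0`
(`fderiv_wedge_eq`): `F` is locally a holomorphic function of `g`. So `F Q` is holomorphic in `g`
with constant modulus, hence a constant `h = ρ e^{iΘ}`. A zero of `Q` cannot occur, as `F Q` would
vanish there against continuity of its modulus (`weierstrass_factor_const`).

Points with `g = ∞` are treated by the half turn about the first axis, which replaces `g` by `1 / g`
and preserves both the data and `h`. The local constants agree by connectedness
(`IsMinimalSurface.exists_hasDataAt`). Finally one point of the surface is translated onto the
model, and the set of points lying on the model is open and closed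
(`IsMinimalSurface.mem_scherkSurface`). -/

noncomputable section

/-! ### Algebra of the Weierstrass integrand and of stereographic projection. -/

namespace Scherk

/-- The real part of `((1 - g²) / 2, i (1 + g²) / 2, g) η`. -/
def nullForm (g η : ℂ) : E3 :=
  !₂[((1 - g ^ 2) / 2 * η).re, (Complex.I / 2 * (1 + g ^ 2) * η).re, (g * η).re]

/-- The left inverse of `nullForm g`. -/
def conullForm (g : ℂ) (A : E3) : ℂ :=
  4 / ((1 + Complex.normSq g : ℝ) : ℂ) ^ 2 *
    ((1 - (starRingEnd ℂ g) ^ 2) / 2 * A 0 - Complex.I / 2 * (1 + (starRingEnd ℂ g) ^ 2) * A 1 +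
      starRingEnd ℂ g * A 2)

/-- Stereographic projection from the north pole. -/
def stereo (v : E3) : ℂ := ((v 0 : ℂ) + Complex.I * (v 1 : ℂ)) / (1 - (v 2 : ℂ))

/-- The differential of `stereo`. -/
def dstereo (v b : E3) : ℂ :=
  (((b 0 : ℂ) + Complex.I * (b 1 : ℂ)) * (1 - (v 2 : ℂ)) +
    ((v 0 : ℂ) + Complex.I * (v 1 : ℂ)) * (b 2 : ℂ)) / (1 - (v 2 : ℂ)) ^ 2

lemma inner_eq (v w : E3) : inner ℝ v w = v 0 * w 0 + v 1 * w 1 + v 2 * w 2 := by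
  simp [PiLp.inner_apply, Fin.sum_univ_three, mul_comm]

lemma norm_sq_eq (v : E3) : ‖v‖ ^ 2 = v 0 ^ 2 + v 1 ^ 2 + v 2 ^ 2 := by
  rw [← real_inner_self_eq_norm_sq, inner_eq]; ring

lemma ext3 {v w : E3} (h0 : v 0 = w 0) (h1 : v 1 = w 1) (h2 : v 2 = w 2) : v = w := by
  ext i; fin_cases i <;> assumption

lemma nullForm_zero' (g η : ℂ) : nullForm g η 0 = ((1 - g ^ 2) / 2 * η).re := rfl
lemma nullForm_one' (g η : ℂ) : nullForm g η 1 = (Complex.I / 2 * (1 + g ^ 2) * η).re := rfl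
lemma nullForm_two' (g η : ℂ) : nullForm g η 2 = (g * η).re := rfl

lemma nullForm_coord0 (g η : ℂ) :
    nullForm g η 0 = ((1 - (g.re ^ 2 - g.im ^ 2)) * η.re + 2 * g.re * g.im * η.im) / 2 := by
  have : (1 - g ^ 2) / 2 * η = ((1 / 2 : ℝ) : ℂ) * ((1 - g * g) * η) := by push_cast; ring
  rw [nullForm_zero', this, Complex.re_ofReal_mul]
  simp; ring

lemma nullForm_coord1 (g η : ℂ) :
    nullForm g η 1 = -((1 + (g.re ^ 2 - g.im ^ 2)) * η.im + 2 * g.re * g.im * η.re) / 2 := by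
  have : Complex.I / 2 * (1 + g ^ 2) * η
      = ((1 / 2 : ℝ) : ℂ) * (Complex.I * ((1 + g * g) * η)) := by push_cast; ring
  rw [nullForm_one', this, Complex.re_ofReal_mul]
  simp; ring

lemma nullForm_coord2 (g η : ℂ) : nullForm g η 2 = g.re * η.re - g.im * η.im := by
  rw [nullForm_two', Complex.mul_re]

/-- The vector `((1 - g²)/2, i(1 + g²)/2, g)` is isotropic of Hermitian square norm `(1 + |g|²)² /
2`, so `nullForm g` is a similarity of ratio `(1 + |g|²) / 2` onto a plane. -/
lemma inner_nullForm (g η ζ : ℂ) :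
    inner ℝ (nullForm g η) (nullForm g ζ)
      = (1 + Complex.normSq g) ^ 2 / 4 * (η.re * ζ.re + η.im * ζ.im) := by
  simp only [inner_eq, nullForm_coord0, nullForm_coord1, nullForm_coord2, Complex.normSq_apply]
  ring

lemma one_add_normSq_pos (g : ℂ) : 0 < 1 + Complex.normSq g := by
  have := Complex.normSq_nonneg g; linarith

lemma nullForm_eq_zero {g η : ℂ} (h : nullForm g η = 0) : η = 0 := by
  have h1 := inner_nullForm g η η
  rw [h, inner_zero_left] at h1
  have h2 := one_add_normSq_pos g
  have h3 : η.re * η.re + η.im * η.im = 0 := by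
    rcases mul_eq_zero.1 h1.symm with h | h
    · exact absurd h (by positivity)
    · exact h
  apply Complex.ext
  · simp only [Complex.zero_re]; nlinarith [mul_self_nonneg η.re, mul_self_nonneg η.im]
  · simp only [Complex.zero_im]; nlinarith [mul_self_nonneg η.re, mul_self_nonneg η.im]

lemma nullForm_sub (g η ζ : ℂ) : nullForm g (η - ζ) = nullForm g η - nullForm g ζ := by
  apply ext3 <;> simp [nullForm_coord0, nullForm_coord1, nullForm_coord2] <;> ring

lemma nullForm_add (g η ζ : ℂ) : nullForm g (η + ζ) = nullForm g η + nullForm g ζ := by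
  apply ext3 <;> simp [nullForm_coord0, nullForm_coord1, nullForm_coord2] <;> ring

lemma nullForm_injective (g : ℂ) : Function.Injective (nullForm g) := fun η ζ h =>
  sub_eq_zero.1 (nullForm_eq_zero (g := g) (by rw [nullForm_sub, h, sub_self]))

lemma conullForm_re (g : ℂ) (A : E3) : (conullForm g A).re
    = 4 / (1 + Complex.normSq g) ^ 2 * ((1 - (g.re ^ 2 - g.im ^ 2)) / 2 * A 0
      - g.re * g.im * A 1 + g.re * A 2) := by
  have : conullForm g A = ((4 / (1 + Complex.normSq g) ^ 2 : ℝ) : ℂ) * (((1 / 2 * A 0 : ℝ) : ℂ) *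
      (1 - (starRingEnd ℂ g) * (starRingEnd ℂ g)) - ((1 / 2 * A 1 : ℝ) : ℂ) * (Complex.I *
        (1 + (starRingEnd ℂ g) * (starRingEnd ℂ g))) + starRingEnd ℂ g * A 2) := by
    rw [conullForm]; push_cast; ring
  rw [this, Complex.re_ofReal_mul]
  congr 1
  simp; ring

lemma conullForm_im (g : ℂ) (A : E3) : (conullForm g A).im
    = 4 / (1 + Complex.normSq g) ^ 2 * (g.re * g.im * A 0
      - (1 + (g.re ^ 2 - g.im ^ 2)) / 2 * A 1 - g.im * A 2) := by
  have : conullForm g A = ((4 / (1 + Complex.normSq g) ^ 2 : ℝ) : ℂ) * (((1 / 2 * A 0 : ℝ) : ℂ) *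
      (1 - (starRingEnd ℂ g) * (starRingEnd ℂ g)) - ((1 / 2 * A 1 : ℝ) : ℂ) * (Complex.I *
        (1 + (starRingEnd ℂ g) * (starRingEnd ℂ g))) + starRingEnd ℂ g * A 2) := by
    rw [conullForm]; push_cast; ring
  rw [this, Complex.im_ofReal_mul]
  congr 1
  simp; ring

lemma conullForm_nullForm (g η : ℂ) : conullForm g (nullForm g η) = η := by
  have h := (one_add_normSq_pos g).ne'
  rw [Complex.normSq_apply] at h
  apply Complex.ext
  · rw [conullForm_re, nullForm_coord0, nullForm_coord1, nullForm_coord2, Complex.normSq_apply]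
    field_simp
    ring
  · rw [conullForm_im, nullForm_coord0, nullForm_coord1, nullForm_coord2, Complex.normSq_apply]
    field_simp
    ring

lemma stereo_re (v : E3) : (stereo v).re = v 0 / (1 - v 2) := by
  have : stereo v = ((v 0 : ℂ) + Complex.I * (v 1 : ℂ)) / ((1 - v 2 : ℝ) : ℂ) := by
    simp [stereo]
  rw [this, Complex.div_ofReal_re]; simp

lemma stereo_im (v : E3) : (stereo v).im = v 1 / (1 - v 2) := by
  have : stereo v = ((v 0 : ℂ) + Complex.I * (v 1 : ℂ)) / ((1 - v 2 : ℝ) : ℂ) := by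
    simp [stereo]
  rw [this, Complex.div_ofReal_im]; simp

lemma dstereo_re (v b : E3) :
    (dstereo v b).re = (b 0 * (1 - v 2) + v 0 * b 2) / (1 - v 2) ^ 2 := by
  have : dstereo v b = (((b 0 : ℂ) + Complex.I * (b 1 : ℂ)) * ((1 - v 2 : ℝ) : ℂ) +
      ((v 0 : ℂ) + Complex.I * (v 1 : ℂ)) * (b 2 : ℂ)) / (((1 - v 2) ^ 2 : ℝ) : ℂ) := by
    simp [dstereo]
  rw [this, Complex.div_ofReal_re]; simp

lemma dstereo_im (v b : E3) :
    (dstereo v b).im = (b 1 * (1 - v 2) + v 1 * b 2) / (1 - v 2) ^ 2 := by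
  have : dstereo v b = (((b 0 : ℂ) + Complex.I * (b 1 : ℂ)) * ((1 - v 2 : ℝ) : ℂ) +
      ((v 0 : ℂ) + Complex.I * (v 1 : ℂ)) * (b 2 : ℂ)) / (((1 - v 2) ^ 2 : ℝ) : ℂ) := by
    simp [dstereo]
  rw [this, Complex.div_ofReal_im]; simp

lemma one_add_normSq_stereo {v : E3} (hv : ‖v‖ = 1) (h2 : v 2 ≠ 1) :
    1 + Complex.normSq (stereo v) = 2 / (1 - v 2) := by
  have h3 : 1 - v 2 ≠ 0 := sub_ne_zero.2 (Ne.symm h2)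
  have h4 := norm_sq_eq v
  rw [hv] at h4
  rw [Complex.normSq_apply, stereo_re, stereo_im]
  field_simp
  linear_combination -h4

lemma stereo_coord0 {v : E3} (hv : ‖v‖ = 1) (h2 : v 2 ≠ 1) :
    v 0 = 2 * (stereo v).re / (1 + Complex.normSq (stereo v)) := by
  have h3 : 1 - v 2 ≠ 0 := sub_ne_zero.2 (Ne.symm h2)
  rw [one_add_normSq_stereo hv h2, stereo_re]; field_simp

lemma stereo_coord1 {v : E3} (hv : ‖v‖ = 1) (h2 : v 2 ≠ 1) :
    v 1 = 2 * (stereo v).im / (1 + Complex.normSq (stereo v)) := by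
  have h3 : 1 - v 2 ≠ 0 := sub_ne_zero.2 (Ne.symm h2)
  rw [one_add_normSq_stereo hv h2, stereo_im]; field_simp

lemma stereo_coord2 {v : E3} (hv : ‖v‖ = 1) (h2 : v 2 ≠ 1) :
    v 2 = (Complex.normSq (stereo v) - 1) / (1 + Complex.normSq (stereo v)) := by
  have h3 : 1 - v 2 ≠ 0 := sub_ne_zero.2 (Ne.symm h2)
  have h4 := one_add_normSq_stereo hv h2
  have h5 : Complex.normSq (stereo v) = 2 / (1 - v 2) - 1 := by linarith
  rw [h5]; field_simp; ring

/-- The plane spanned by the values of `nullForm (stereo v)` is the orthogonal complement of `v`;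
hence every tangent vector has a complex coordinate. -/
lemma nullForm_conullForm {v A : E3} (hv : ‖v‖ = 1) (h2 : v 2 ≠ 1) (hA : inner ℝ v A = 0) :
    nullForm (stereo v) (conullForm (stereo v) A) = A := by
  rw [inner_eq, stereo_coord0 hv h2, stereo_coord1 hv h2, stereo_coord2 hv h2] at hA
  set g := stereo v
  have h := (one_add_normSq_pos g).ne'
  field_simp at hA
  rw [Complex.normSq_apply] at h hA
  apply ext3
  · rw [nullForm_coord0, conullForm_re, conullForm_im, Complex.normSq_apply]
    field_simp
    linear_combination (-8 * g.re) * hA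
  · rw [nullForm_coord1, conullForm_re, conullForm_im, Complex.normSq_apply]
    field_simp
    linear_combination (-8 * g.im) * hA
  · rw [nullForm_coord2, conullForm_re, conullForm_im, Complex.normSq_apply]
    field_simp
    linear_combination (-2 * (g.re * g.re + g.im * g.im - 1)) * hA

/-- Inverse stereographic projection is conformal of ratio `2 / (1 + |g|²)` and reverses the
orientation given by `nullForm g`; this is the source of the conjugate. -/
lemma conullForm_eq_dstereo {v b : E3} (hv : ‖v‖ = 1) (h2 : v 2 ≠ 1) (hb : inner ℝ v b = 0) :
    conullForm (stereo v) b = ((4 / (1 + Complex.normSq (stereo v)) ^ 2 : ℝ) : ℂ) *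
      starRingEnd ℂ (dstereo v b) := by
  have h3 : 1 - v 2 ≠ 0 := sub_ne_zero.2 (Ne.symm h2)
  have h4 := norm_sq_eq v
  rw [hv] at h4
  rw [inner_eq] at hb
  apply Complex.ext
  · rw [conullForm_re, Complex.re_ofReal_mul, Complex.conj_re, dstereo_re, stereo_re, stereo_im]
    congr 1
    field_simp
    linear_combination (-2 * v 0) * hb - b 0 * h4
  · rw [conullForm_im, Complex.im_ofReal_mul, Complex.conj_im, dstereo_im, stereo_re, stereo_im]
    congr 1
    field_simp
    linear_combination (2 * v 1) * hb + b 1 * h4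

end Scherk

/-! ### The Weierstrass representation at a point. -/

namespace Scherk

lemma dstereo_add (v b c : E3) : dstereo v (b + c) = dstereo v b + dstereo v c := by
  simp only [dstereo, PiLp.add_apply, Complex.ofReal_add]; ring

lemma dstereo_smul (v : E3) (x : ℝ) (b : E3) : dstereo v (x • b) = x * dstereo v b := by
  simp only [dstereo, PiLp.smul_apply, smul_eq_mul, Complex.ofReal_mul]; ring

lemma euclidean_two_eq (v : EuclideanSpace ℝ (Fin 2)) :
    v = v 0 • EuclideanSpace.single 0 (1 : ℝ) + v 1 • EuclideanSpace.single 1 (1 : ℝ) := by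
  ext i; fin_cases i <;> simp

lemma nullForm_smul (g : ℂ) (x : ℝ) (η : ℂ) : nullForm g (x * η) = x • nullForm g η := by
  apply ext3 <;> simp [nullForm_coord0, nullForm_coord1, nullForm_coord2] <;> ring

/-- A symmetric, trace-free pair of real linear maps `ℝ² → ℂ` is complex proportional. -/
lemma cross_eq_of_symm_of_trace {α₀ α₁ γ₀ γ₁ : ℂ}
    (hm : α₀.im * α₁.re - α₀.re * α₁.im ≠ 0) (hs : (α₀ * γ₁).re = (α₁ * γ₀).re)
    (ht : Complex.normSq α₁ * (α₀ * γ₀).re + Complex.normSq α₀ * (α₁ * γ₁).re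
      - (α₀.re * α₁.re + α₀.im * α₁.im) * ((α₀ * γ₁).re + (α₁ * γ₀).re) = 0) :
    α₀ * γ₁ = α₁ * γ₀ := by
  apply Complex.ext hs
  -- This product is, as a polynomial, the left side of the trace condition.
  have : (α₀.im * α₁.re - α₀.re * α₁.im) * ((α₀ * γ₁).im - (α₁ * γ₀).im) = 0 := by
    simp only [Complex.normSq_apply, Complex.mul_re, Complex.mul_im] at *
    linear_combination ht
  rcases mul_eq_zero.1 this with h | h
  · exact absurd h hm
  · linarith

lemma inv_mul_trace_two (A B : Matrix (Fin 2) (Fin 2) ℝ) (hA : A.det ≠ 0) :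
    (A⁻¹ * B).trace * A.det = A 1 1 * B 0 0 + A 0 0 * B 1 1 - A 0 1 * B 1 0 - A 1 0 * B 0 1 := by
  rw [Matrix.inv_def, Ring.inverse_eq_inv', Matrix.adjugate_fin_two, Matrix.smul_mul,
    Matrix.trace_smul, smul_eq_mul, mul_comm, ← mul_assoc, mul_inv_cancel₀ hA, one_mul]
  rw [Matrix.trace_fin_two, Matrix.mul_apply, Matrix.mul_apply, Fin.sum_univ_two, Fin.sum_univ_two]
  simp only [Matrix.of_apply, Matrix.cons_val', Matrix.cons_val_zero, Matrix.cons_val_one,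
    Matrix.cons_val_fin_one]
  ring

variable {M : Type*} [TopologicalSpace M] [ChartedSpace (EuclideanSpace ℝ (Fin 2)) M]

/-- With `α`, `γ` the complex values of `dX` and `dg`, one has `⟨dX v, dn w⟩ = Re (α v * γ w)`,
because the conjugate in `dn` cancels the one in the Hermitian product. Symmetry kills the real part
of `α₀ γ₁ - α₁ γ₀`, minimality the imaginary part. The curvature identity is `K = det II / det I`
computed with `α = F γ`. -/
theorem exists_weierstrass {X n : M → E3} {p : M} (hn : ‖n p‖ = 1) (h2 : n p 2 ≠ 1)
    (hA : ∀ v, inner ℝ (n p) (diff X p v) = 0) (hB : ∀ v, inner ℝ (n p) (diff n p v) = 0)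
    (hinj : Function.Injective (diff X p))
    (hsymm : ∀ v w, inner ℝ (diff X p v) (diff n p w) = inner ℝ (diff X p w) (diff n p v))
    (hmin : meanCurvature X n p = 0) (hK : gaussCurvature X n p < 0) :
    ∃ F : ℂ, (∀ v, diff X p v = nullForm (stereo (n p)) (F * dstereo (n p) (diff n p v))) ∧
      Complex.normSq F * (1 + Complex.normSq (stereo (n p))) ^ 4 * -gaussCurvature X n p = 16 := by
  set g := stereo (n p) with hg
  have hl := one_add_normSq_pos g
  set α : EuclideanSpace ℝ (Fin 2) → ℂ := fun v => conullForm g (diff X p v) with hα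
  set γ : EuclideanSpace ℝ (Fin 2) → ℂ := fun v => dstereo (n p) (diff n p v) with hγ
  have hAα : ∀ v, diff X p v = nullForm g (α v) := fun v => (nullForm_conullForm hn h2 (hA v)).symm
  have hBγ : ∀ v, diff n p v = nullForm g (((4 / (1 + Complex.normSq g) ^ 2 : ℝ) : ℂ) *
      starRingEnd ℂ (γ v)) := fun v => by
    rw [hγ, ← conullForm_eq_dstereo hn h2 (hB v), nullForm_conullForm hn h2 (hB v)]
  have hAA : ∀ v w, inner ℝ (diff X p v) (diff X p w)
      = (1 + Complex.normSq g) ^ 2 / 4 * ((α v).re * (α w).re + (α v).im * (α w).im) := fun v w => by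
    rw [hAα v, hAα w, inner_nullForm]
  have hAB : ∀ v w, inner ℝ (diff X p v) (diff n p w) = (α v * γ w).re := fun v w => by
    rw [hAα v, hBγ w, inner_nullForm, Complex.re_ofReal_mul, Complex.im_ofReal_mul,
      Complex.mul_re, Complex.conj_re, Complex.conj_im]
    field_simp
    ring
  set e₀ : EuclideanSpace ℝ (Fin 2) := EuclideanSpace.single 0 1 with he₀
  set e₁ : EuclideanSpace ℝ (Fin 2) := EuclideanSpace.single 1 1 with he₁
  set m := (α e₀).im * (α e₁).re - (α e₀).re * (α e₁).im with hm
  -- Up to sign `m` is the determinant of `α` as a real linear map from the plane to `ℂ`, so it is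
  -- nonzero because `X` is an immersion.
  have hm0 : m ≠ 0 := by
    intro h0
    have key : ∀ x y : ℝ, (x : ℂ) * α e₀ + y * α e₁ = 0 → x = 0 ∧ y = 0 := by
      intro x y hxy
      have : diff X p (x • e₀ + y • e₁) = diff X p 0 := by
        rw [map_add, map_smul, map_smul, hAα e₀, hAα e₁, ← nullForm_smul, ← nullForm_smul,
          ← nullForm_add, hxy, map_zero]
        apply ext3 <;> simp [nullForm_coord0, nullForm_coord1, nullForm_coord2]
      have h := hinj this
      constructor
      · simpa [he₀, he₁] using congrArg (fun v : EuclideanSpace ℝ (Fin 2) => v 0) h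
      · simpa [he₀, he₁] using congrArg (fun v : EuclideanSpace ℝ (Fin 2) => v 1) h
    have h1 := key (α e₁).im (-(α e₀).im) (by
      apply Complex.ext <;> simp <;> linarith)
    have h2 := key (α e₁).re (-(α e₀).re) (by
      apply Complex.ext <;> simp <;> linarith)
    have h3 : α e₁ = 0 := Complex.ext h2.1 h1.1
    have h4 := key 0 1 (by rw [h3]; simp)
    exact one_ne_zero h4.2
  have hI : ∀ i j, firstForm X p i j = (1 + Complex.normSq g) ^ 2 / 4 *
      ((α (EuclideanSpace.single i 1)).re * (α (EuclideanSpace.single j 1)).re +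
        (α (EuclideanSpace.single i 1)).im * (α (EuclideanSpace.single j 1)).im) := fun i j => hAA _ _
  have hII : ∀ i j, secondForm X n p i j =
      -(α (EuclideanSpace.single i 1) * γ (EuclideanSpace.single j 1)).re := fun i j => by
    rw [← hAB]; rfl
  have hdetI : (firstForm X p).det = ((1 + Complex.normSq g) ^ 2 / 4) ^ 2 * m ^ 2 := by
    rw [Matrix.det_fin_two, hI, hI, hI, hI, hm]; ring
  have hdet0 : (firstForm X p).det ≠ 0 := by rw [hdetI]; positivity
  have hs : (α e₀ * γ e₁).re = (α e₁ * γ e₀).re := by rw [← hAB, ← hAB, hsymm]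
  have htr : (shapeOperator X n p).trace = 0 := by
    rw [meanCurvature] at hmin; linarith
  have hcross : α e₀ * γ e₁ = α e₁ * γ e₀ := by
    apply cross_eq_of_symm_of_trace hm0 hs
    have h := inv_mul_trace_two (firstForm X p) (secondForm X n p) hdet0
    rw [shapeOperator] at htr
    rw [htr, hI, hI, hI, hI, hII, hII, hII, hII, ← he₀, ← he₁, zero_mul] at h
    have h4 : (1 + Complex.normSq g) ^ 2 / 4 ≠ 0 := by positivity
    apply mul_left_cancel₀ h4
    simp only [Complex.normSq_apply (α e₀), Complex.normSq_apply (α e₁)]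
    linear_combination h
  have hdetII : (secondForm X n p).det = -m ^ 2 * Complex.normSq (γ e₀) / Complex.normSq (α e₀) ∧
      α e₀ ≠ 0 := by
    have h0 : α e₀ ≠ 0 := by
      intro h; apply hm0; rw [hm, h]; simp
    refine ⟨?_, h0⟩
    rw [eq_div_iff (by simpa using h0), Matrix.det_fin_two, hII, hII, hII, hII, ← he₀, ← he₁, hm]
    have h1 : γ e₁ = α e₁ * γ e₀ / α e₀ := by rw [eq_div_iff h0, ← hcross, mul_comm]
    obtain ⟨u, hu⟩ : ∃ u, γ e₀ = u * α e₀ := ⟨γ e₀ / α e₀, by field_simp⟩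
    have h2 : γ e₁ = u * α e₁ := by rw [h1, hu]; field_simp
    rw [h2, hu]
    simp only [Complex.normSq_apply, Complex.mul_re, Complex.mul_im]
    ring
  obtain ⟨hdetII, hα0⟩ := hdetII
  have hKm : gaussCurvature X n p * (firstForm X p).det = (secondForm X n p).det := by
    rw [gaussCurvature, shapeOperator, Matrix.det_mul, Matrix.det_nonsing_inv,
      Ring.inverse_eq_inv']
    field_simp
  -- Negative curvature makes the Gauss map an immersion, which allows division by `γ e₀`.
  have hγ0 : γ e₀ ≠ 0 := by
    intro h
    rw [h, map_zero, mul_zero, zero_div] at hdetII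
    rw [hdetII] at hKm
    rcases mul_eq_zero.1 hKm with h | h
    · exact hK.ne h
    · exact hdet0 h
  refine ⟨α e₀ / γ e₀, fun v => ?_, ?_⟩
  · have e1 : α e₁ = α e₀ / γ e₀ * γ e₁ := by field_simp; rw [← hcross]
    have e0 : α e₀ = α e₀ / γ e₀ * γ e₀ := by field_simp
    change _ = nullForm g (α e₀ / γ e₀ * γ v)
    have hγv : γ v = v 0 * γ e₀ + v 1 * γ e₁ := by
      simp only [hγ]
      conv_lhs => rw [euclidean_two_eq v, map_add, map_smul, map_smul, dstereo_add, dstereo_smul,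
        dstereo_smul]
    conv_lhs => rw [euclidean_two_eq v, map_add, map_smul, map_smul, ← he₀, ← he₁, hAα e₀, hAα e₁,
      ← nullForm_smul, ← nullForm_smul, ← nullForm_add]
    congr 1
    rw [hγv, e1]
    field_simp
  · have a0 : Complex.normSq (α e₀) ≠ 0 := by simpa using hα0
    have g0 : Complex.normSq (γ e₀) ≠ 0 := by simpa using hγ0
    rw [hdetII, hdetI] at hKm
    rw [Complex.normSq_div]
    field_simp at hKm ⊢
    linear_combination -hKm

end Scherk

/-! ### Closedness of `dX` and constancy of the Weierstrass factor. -/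

namespace Scherk
open Filter Topology

lemma finite_sq_eq (c : ℂ) : {z : ℂ | z ^ 2 = c}.Finite := by
  obtain ⟨w, hw⟩ := IsAlgClosed.exists_pow_nat_eq c (n := 2) (by norm_num)
  refine (Set.toFinite {w, -w}).subset fun z hz => ?_
  exact sq_eq_sq_iff_eq_or_eq_neg.1 ((show z ^ 2 = c from hz).trans hw.symm)

lemma finite_quartic_zeros (θ : ℝ) : {z : ℂ | quartic θ z 1 = 0}.Finite := by
  refine ((finite_sq_eq (Complex.exp (2 * Complex.I * θ))).union
    (finite_sq_eq (Complex.exp (-(2 * Complex.I * θ))))).subset ?_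
  intro z hz
  simp only [Set.mem_ofPred_eq, quartic, one_pow, mul_one, mul_eq_zero, sub_eq_zero] at hz
  exact hz

lemma differentiableAt_quartic (θ : ℝ) (z : ℂ) :
    DifferentiableAt ℂ (fun z => quartic θ z 1) z := by
  unfold quartic; fun_prop

section

variable {E : Type*} [NormedAddCommGroup E] [NormedSpace ℝ E]

lemma differentiableAt_conullForm {G : E → ℂ} {A : E → E3} {x : E}
    (hG : DifferentiableAt ℝ G x) (hA : DifferentiableAt ℝ A x) :
    DifferentiableAt ℝ (fun y => conullForm (G y) (A y)) x := by
  have hc : DifferentiableAt ℝ (fun y => starRingEnd ℂ (G y)) x :=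
    Complex.conjCLE.differentiableAt.comp x hG
  have hAi : ∀ i, DifferentiableAt ℝ (fun y => ((A y i : ℝ) : ℂ)) x := fun i =>
    Complex.ofRealCLM.differentiableAt.comp x
      ((EuclideanSpace.proj (𝕜 := ℝ) i).differentiableAt.comp x hA)
  have h0 := hAi 0
  have h1 := hAi 1
  have h2 := hAi 2
  have hd : (1 + G x * starRingEnd ℂ (G x)) ^ 2 ≠ 0 := by
    rw [Complex.mul_conj]
    have := (one_add_normSq_pos (G x)).ne'
    exact_mod_cast pow_ne_zero 2 this
  simp only [conullForm, Complex.ofReal_add, Complex.ofReal_one, ← Complex.mul_conj]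
  fun_prop (disch := assumption)

lemma hasFDerivAt_re_mul {Φ : ℂ → ℂ} {Φ' : ℂ} {G F D : E → ℂ} {G' F' D' : E →L[ℝ] ℂ} {x : E}
    (hΦ : HasDerivAt Φ Φ' (G x)) (hG : HasFDerivAt G G' x) (hF : HasFDerivAt F F' x)
    (hD : HasFDerivAt D D' x) :
    ∃ L : E →L[ℝ] ℝ, HasFDerivAt (fun y => (Φ (G y) * (F y * D y)).re) L x ∧
      ∀ w, L w = (Φ' * G' w * (F x * D x) + Φ (G x) * (F' w * D x + F x * D' w)).re := by
  have h1 : HasFDerivAt (fun y => Φ (G y)) (Φ' • G') x :=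
    HasDerivAt.comp_hasFDerivAt x hΦ hG
  have h2 := Complex.reCLM.hasFDerivAt.comp x (h1.mul (hF.mul hD))
  refine ⟨_, h2, fun w => ?_⟩
  simp only [ContinuousLinearMap.comp_apply, Complex.reCLM_apply, add_apply,
    smul_apply, smul_eq_mul]
  congr 1
  rw [Pi.mul_apply]
  ring

/-- If `dX = nullForm G (F dG)`, then `dF ∧ dG = 0`. -/
lemma fderiv_wedge_eq {X : E → E3} {G F : E → ℂ} {x : E}
    (hX : ContDiffAt ℝ 2 X x) (hG : ContDiffAt ℝ 2 G x) (hF : DifferentiableAt ℝ F x)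
    (hW : ∀ᶠ y in 𝓝 x, ∀ v, fderiv ℝ X y v = nullForm (G y) (F y * fderiv ℝ G y v)) (v w : E) :
    fderiv ℝ F x w * fderiv ℝ G x v = fderiv ℝ F x v * fderiv ℝ G x w := by
  have hXs : IsSymmSndFDerivAt ℝ X x := hX.isSymmSndFDerivAt (by simp)
  have hGs : IsSymmSndFDerivAt ℝ G x := hG.isSymmSndFDerivAt (by simp)
  have hX1 : DifferentiableAt ℝ (fderiv ℝ X) x :=
    (hX.fderiv_right (m := 1) (by norm_num)).differentiableAt (by norm_num)
  have hG1 : DifferentiableAt ℝ (fderiv ℝ G) x :=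
    (hG.fderiv_right (m := 1) (by norm_num)).differentiableAt (by norm_num)
  have hG0 : HasFDerivAt G (fderiv ℝ G x) x := (hG.differentiableAt (by norm_num)).hasFDerivAt
  have happ : ∀ {V : Type} [NormedAddCommGroup V] [NormedSpace ℝ V] {f : E → E →L[ℝ] V}
      (_ : DifferentiableAt ℝ f x) (v : E),
      HasFDerivAt (fun y => f y v) ((fderiv ℝ f x).flip v) x := by
    intro V _ _ f hf v
    exact (ContinuousLinearMap.apply ℝ V v).hasFDerivAt.comp x hf.hasFDerivAt
  -- Here `Φ` is one of the three coefficients of the integrand. In the second derivative of the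
  -- corresponding coordinate of `X` every term is symmetric in `v` and `w` except `Φ * dF(w) *
  -- dG(v)`.
  have key : ∀ (i : Fin 3) (Φ : ℂ → ℂ) (Φ' : ℂ), HasDerivAt Φ Φ' (G x) →
      (∀ g η, nullForm g η i = (Φ g * η).re) → ∀ v w : E, (fderiv ℝ (fderiv ℝ X) x w v) i =
        (Φ' * fderiv ℝ G x w * (F x * fderiv ℝ G x v) + Φ (G x) *
          (fderiv ℝ F x w * fderiv ℝ G x v + F x * fderiv ℝ (fderiv ℝ G) x w v)).re := by
    intro i Φ Φ' hΦ hi v w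
    obtain ⟨L, hL, hLw⟩ := hasFDerivAt_re_mul hΦ hG0 hF.hasFDerivAt (happ hG1 v)
    have h1 := (EuclideanSpace.proj (𝕜 := ℝ) i).hasFDerivAt.comp x (happ hX1 v)
    have h2 := h1.congr_of_eventuallyEq (f₁ := fun y => (Φ (G y) * (F y * fderiv ℝ G y v)).re) (by
      filter_upwards [hW] with y hy
      simp only [Function.comp, hy]
      exact (hi _ _).symm)
    have h3 := congrArg (fun T => T w) (h2.unique hL)
    simp only [hLw] at h3
    exact h3
  have hzero : ∀ (i : Fin 3) (Φ : ℂ → ℂ) (Φ' : ℂ), HasDerivAt Φ Φ' (G x) →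
      (∀ g η, nullForm g η i = (Φ g * η).re) → nullForm (G x)
        (fderiv ℝ F x w * fderiv ℝ G x v - fderiv ℝ F x v * fderiv ℝ G x w) i = 0 := by
    intro i Φ Φ' hΦ hi
    have h1 := key i Φ Φ' hΦ hi v w
    have h2 := key i Φ Φ' hΦ hi w v
    rw [hXs.eq w v, h2, hGs.eq v w, ← sub_eq_zero, ← Complex.sub_re] at h1
    rw [hi, ← neg_eq_zero, ← Complex.neg_re, ← h1]
    congr 1
    ring
  refine sub_eq_zero.1 (nullForm_eq_zero (g := G x) (ext3 ?_ ?_ ?_))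
  · exact hzero 0 (fun g => (1 - g ^ 2) / 2) _ (DifferentiableAt.hasDerivAt (by fun_prop))
      (fun g η => rfl)
  · exact hzero 1 (fun g => Complex.I / 2 * (1 + g ^ 2)) _
      (DifferentiableAt.hasDerivAt (by fun_prop)) (fun g η => rfl)
  · exact hzero 2 (fun g => g) _ (hasDerivAt_id (G x)) (fun g η => rfl)

end

/-- A holomorphic function of `G` of constant modulus is constant. The argument uses real
derivatives and `dH ∧ dG = 0` instead of taking `G` as a coordinate. -/
theorem weierstrass_factor_const {s : Set (EuclideanSpace ℝ (Fin 2))} (hs : IsOpen s)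
    (hs' : IsPreconnected s) {X : EuclideanSpace ℝ (Fin 2) → E3}
    {G F : EuclideanSpace ℝ (Fin 2) → ℂ} (hX : ContDiffOn ℝ ∞ X s) (hG : ContDiffOn ℝ ∞ G s)
    (hW : ∀ x ∈ s, ∀ v, fderiv ℝ X x v = nullForm (G x) (F x * fderiv ℝ G x v))
    (hinj : ∀ x ∈ s, Function.Injective (fderiv ℝ G x)) {θ c : ℝ} (hc : 0 < c)
    (hF : ∀ x ∈ s, quartic θ (G x) 1 ≠ 0 → Complex.normSq (F x * quartic θ (G x) 1) = c) :
    (∀ x ∈ s, quartic θ (G x) 1 ≠ 0) ∧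
      ∀ x ∈ s, ∀ y ∈ s, F x * quartic θ (G x) 1 = F y * quartic θ (G y) 1 := by
  have hXx : ∀ x ∈ s, ContDiffAt ℝ 2 X x := fun x hx =>
    (hX.contDiffAt (hs.mem_nhds hx)).of_le (by norm_cast)
  have hGx : ∀ x ∈ s, ContDiffAt ℝ 2 G x := fun x hx =>
    (hG.contDiffAt (hs.mem_nhds hx)).of_le (by norm_cast)
  have hGd : ∀ x ∈ s, DifferentiableAt ℝ G x := fun x hx =>
    (hGx x hx).differentiableAt (by norm_num)
  set e : EuclideanSpace ℝ (Fin 2) := EuclideanSpace.single 0 1 with he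
  have he0 : e ≠ 0 := by
    intro h
    simpa [he] using congrArg (fun v : EuclideanSpace ℝ (Fin 2) => v 0) h
  have hdG : ∀ x ∈ s, fderiv ℝ G x e ≠ 0 := fun x hx h =>
    he0 (hinj x hx (by rw [h, map_zero]))
  have hFd : ∀ x ∈ s, DifferentiableAt ℝ F x := by
    intro x hx
    -- `F` is only given pointwise; this formula recovers it from `X` and `G` and shows that it is
    -- differentiable.
    have h1 : F =ᶠ[𝓝 x] fun y => conullForm (G y) (fderiv ℝ X y e) / fderiv ℝ G y e := by
      filter_upwards [hs.mem_nhds hx] with y hy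
      rw [hW y hy, conullForm_nullForm, mul_div_cancel_right₀ _ (hdG y hy)]
    refine DifferentiableAt.congr_of_eventuallyEq ?_ h1
    have h2 : DifferentiableAt ℝ (fderiv ℝ X) x :=
      ((hXx x hx).fderiv_right (m := 1) (by norm_num)).differentiableAt (by norm_num)
    have h3 : DifferentiableAt ℝ (fderiv ℝ G) x :=
      ((hGx x hx).fderiv_right (m := 1) (by norm_num)).differentiableAt (by norm_num)
    have h4 : DifferentiableAt ℝ (fun y => (fderiv ℝ G y e)⁻¹) x :=
      (h3.clm_apply (differentiableAt_const e)).inv (hdG x hx)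
    simp only [div_eq_mul_inv]
    exact (differentiableAt_conullForm (hGd x hx) (h2.clm_apply (differentiableAt_const e))).mul h4
  have hQd : ∀ x ∈ s, DifferentiableAt ℝ (fun y => quartic θ (G y) 1) x := fun x hx =>
    ((differentiableAt_quartic θ (G x)).restrictScalars ℝ).comp x (hGd x hx)
  -- As `dG` is injective and the quartic has finitely many zeros, a zero would be isolated. Nearby
  -- the square modulus is `c > 0`, while by continuity it tends to `0`.
  have hQ : ∀ x ∈ s, quartic θ (G x) 1 ≠ 0 := by
    intro x hx h0
    have hanti : ∃ C, AntilipschitzWith C (fderiv ℝ G x) := by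
      obtain ⟨K, -, hK⟩ := (fderiv ℝ G x).toLinearMap.exists_antilipschitzWith
        (LinearMap.ker_eq_bot.2 (hinj x hx))
      exact ⟨K, hK⟩
    have h1 : ∀ᶠ y in 𝓝[≠] x, G y ≠ G x := (hGd x hx).hasFDerivAt.eventually_ne hanti
    have h2 : ∀ᶠ z in 𝓝 (G x), z ∉ {z : ℂ | quartic θ z 1 = 0} \ {G x} :=
      ((finite_quartic_zeros θ).subset Set.sdiff_subset).isClosed.isOpen_compl.mem_nhds
        (by simp)
    have h3 : ∀ᶠ y in 𝓝[≠] x, Complex.normSq (F y * quartic θ (G y) 1) = c := by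
      filter_upwards [h1, mem_nhdsWithin_of_mem_nhds ((hGd x hx).continuousAt.eventually h2),
        mem_nhdsWithin_of_mem_nhds (hs.mem_nhds hx)] with y hy1 hy2 hy3
      exact hF y hy3 fun h => hy2 ⟨h, hy1⟩
    have h4 : Tendsto (fun y => Complex.normSq (F y * quartic θ (G y) 1)) (𝓝[≠] x)
        (𝓝 (Complex.normSq (F x * quartic θ (G x) 1))) :=
      ((Complex.continuous_normSq.continuousAt.comp
        ((hFd x hx).mul (hQd x hx)).continuousAt).tendsto).mono_left nhdsWithin_le_nhds
    have h5 : Tendsto (fun y => Complex.normSq (F y * quartic θ (G y) 1)) (𝓝[≠] x) (𝓝 c) :=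
      tendsto_const_nhds.congr' (by filter_upwards [h3] with y hy using hy.symm)
    have h6 := tendsto_nhds_unique h4 h5
    rw [h0, mul_zero, map_zero] at h6
    exact hc.ne h6
  refine ⟨hQ, ?_⟩
  set H := fun y => F y * quartic θ (G y) 1 with hH
  have hHd : ∀ x ∈ s, DifferentiableAt ℝ H x := fun x hx => (hFd x hx).mul (hQd x hx)
  have hH0 : ∀ x ∈ s, fderiv ℝ H x = 0 := by
    intro x hx
    have hFwedge := fderiv_wedge_eq (hXx x hx) (hGx x hx) (hFd x hx)
      (by filter_upwards [hs.mem_nhds hx] with y hy using hW y hy)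
    obtain ⟨q, hq⟩ : ∃ q : ℂ, ∀ w, fderiv ℝ H x w
        = fderiv ℝ F x w * quartic θ (G x) 1 + q * fderiv ℝ G x w := by
      have h1 : HasFDerivAt (fun y => quartic θ (G y) 1) _ x :=
        (differentiableAt_quartic θ (G x)).hasDerivAt.comp_hasFDerivAt x (hGd x hx).hasFDerivAt
      have h2 := ((hFd x hx).hasFDerivAt.mul h1).fderiv
      refine ⟨F x * deriv (fun z => quartic θ z 1) (G x), fun w => ?_⟩
      change fderiv ℝ (F * fun y => quartic θ (G y) 1) x w = _
      rw [h2]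
      simp only [add_apply, smul_apply, smul_eq_mul]
      ring
    have hwedge : ∀ v w, fderiv ℝ H x w * fderiv ℝ G x v = fderiv ℝ H x v * fderiv ℝ G x w := by
      intro v w
      rw [hq, hq]
      linear_combination quartic θ (G x) 1 * hFwedge v w
    have hre : ∀ w, (starRingEnd ℂ (H x) * fderiv ℝ H x w).re = 0 := by
      intro w
      have h1 : (fun y => ‖H y‖ ^ 2) =ᶠ[𝓝 x] fun _ => c := by
        filter_upwards [hs.mem_nhds hx] with y hy
        rw [← Complex.normSq_eq_norm_sq]
        exact hF y hy (hQ y hy)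
      have h2 := (hHd x hx).hasFDerivAt.norm_sq
      have h3 := h2.unique ((hasFDerivAt_const c x).congr_of_eventuallyEq h1)
      have h4 := congrArg (fun T => T w) h3
      simp only [smul_apply, ContinuousLinearMap.comp_apply,
        innerSL_apply_apply, zero_apply, Complex.inner, nsmul_eq_mul] at h4
      simpa [mul_comm] using h4
    have hsurj : Function.Surjective (fderiv ℝ G x) := by
      have := (LinearMap.injective_iff_surjective_of_finrank_eq_finrank
        (f := (fderiv ℝ G x).toLinearMap) (by simp)).1 (hinj x hx)
      exact this
    -- Vectors with `dG a = 1` and `dG b = i` give `dH b = i dH a`. Since `conj H * dH` has zero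
    -- real part on both, `conj H * dH a = 0`.
    obtain ⟨a, ha⟩ := hsurj 1
    obtain ⟨b, hb⟩ := hsurj Complex.I
    have hlin : ∀ w, fderiv ℝ H x w = fderiv ℝ H x a * fderiv ℝ G x w := by
      intro w
      rw [← hwedge a w, ha, mul_one]
    have h1 := hre a
    have h2 := hre b
    rw [hlin b, hb, ← mul_assoc, Complex.mul_I_re, neg_eq_zero] at h2
    have h3 : starRingEnd ℂ (H x) * fderiv ℝ H x a = 0 := Complex.ext h1 h2
    have h4 : H x ≠ 0 := by
      intro h
      have := hF x hx (hQ x hx)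
      rw [show F x * quartic θ (G x) 1 = 0 from h, map_zero] at this
      exact hc.ne this
    have h5 : fderiv ℝ H x a = 0 := by
      rcases mul_eq_zero.1 h3 with h | h
      · exact absurd (by simpa using h) h4
      · exact h
    ext w
    rw [hlin w, h5, zero_mul]; rfl
  intro x hx y hy
  exact hs.is_const_of_fderiv_eq_zero hs' (fun z hz => (hHd z hz).differentiableWithinAt)
    (fun z hz => hH0 z hz) hx hy

end Scherk

/-! ### Differential identities on the surface, read in charts. -/

namespace Scherk
open Filter Topology

lemma inner_fderiv_eq_zero_of_norm_eq_one {E : Type*} [NormedAddCommGroup E] [NormedSpace ℝ E]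
    {n : E → E3} {x : E} (hn : DifferentiableAt ℝ n x) (h : ∀ᶠ y in 𝓝 x, ‖n y‖ = 1) (v : E) :
    inner ℝ (n x) (fderiv ℝ n x v) = 0 := by
  have h1 : (fun y => ‖n y‖ ^ 2) =ᶠ[𝓝 x] fun _ => 1 := by
    filter_upwards [h] with y hy
    rw [hy, one_pow]
  have h2 := hn.hasFDerivAt.norm_sq.unique ((hasFDerivAt_const (1 : ℝ) x).congr_of_eventuallyEq h1)
  have h3 := congrArg (fun T => T v) h2
  simpa using h3

/-- Differentiating `⟨n, dX v⟩ = 0` in the direction `w` turns the left side into `-⟨n, D²X(w, v)⟩`,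
which is symmetric. -/
lemma inner_fderiv_symm {E : Type*} [NormedAddCommGroup E] [NormedSpace ℝ E]
    {X n : E → E3} {x : E} (hX : ContDiffAt ℝ 2 X x) (hn : DifferentiableAt ℝ n x)
    (h : ∀ᶠ y in 𝓝 x, ∀ v, inner ℝ (n y) (fderiv ℝ X y v) = 0) (v w : E) :
    inner ℝ (fderiv ℝ X x v) (fderiv ℝ n x w) = inner ℝ (fderiv ℝ X x w) (fderiv ℝ n x v) := by
  have hX1 : DifferentiableAt ℝ (fderiv ℝ X) x :=
    (hX.fderiv_right (m := 1) (by norm_num)).differentiableAt (by norm_num)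
  have hs : IsSymmSndFDerivAt ℝ X x := hX.isSymmSndFDerivAt (by simp)
  have key : ∀ v w, inner ℝ (n x) (fderiv ℝ (fderiv ℝ X) x w v) +
      inner ℝ (fderiv ℝ n x w) (fderiv ℝ X x v) = 0 := by
    intro v w
    have h1 : HasFDerivAt (fun y => fderiv ℝ X y v) ((fderiv ℝ (fderiv ℝ X) x).flip v) x :=
      (ContinuousLinearMap.apply ℝ E3 v).hasFDerivAt.comp x hX1.hasFDerivAt
    have h2 : (fun y => inner ℝ (n y) (fderiv ℝ X y v)) =ᶠ[𝓝 x] fun _ => (0 : ℝ) := by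
      filter_upwards [h] with y hy using hy v
    have h3 := (hn.hasFDerivAt.inner ℝ h1).unique
      ((hasFDerivAt_const (0 : ℝ) x).congr_of_eventuallyEq h2)
    have h4 := congrArg (fun T => T w) h3
    simpa using h4
  have h1 := key v w
  have h2 := key w v
  rw [hs.eq w v] at h1
  rw [real_inner_comm] at h1 h2
  rw [real_inner_comm (fderiv ℝ n x w), real_inner_comm (fderiv ℝ n x v)]
  rw [real_inner_comm] at h1 h2
  linarith

lemma exists_hasFDerivAt_stereo {v : E3} (h2 : v 2 ≠ 1) :
    ∃ L : E3 →L[ℝ] ℂ, HasFDerivAt stereo L v ∧ ∀ b, L b = dstereo v b := by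
  have hd : (1 - (v 2 : ℂ)) ≠ 0 := by
    rw [sub_ne_zero]; exact_mod_cast h2.symm
  have hi : ∀ i : Fin 3, HasFDerivAt (fun w : E3 => (w i : ℂ))
      (Complex.ofRealCLM.comp (EuclideanSpace.proj (𝕜 := ℝ) i)) v := fun i =>
    (Complex.ofRealCLM.comp (EuclideanSpace.proj (𝕜 := ℝ) i)).hasFDerivAt
  have h := ((hi 0).add ((hi 1).const_mul Complex.I)).mul
    ((hasDerivAt_inv hd).comp_hasFDerivAt v ((hi 2).const_sub 1))
  refine ⟨_, h, fun b => ?_⟩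
  simp only [dstereo, add_apply, smul_apply, ContinuousLinearMap.comp_apply, neg_apply,
    EuclideanSpace.coe_proj, Complex.ofRealCLM_apply, smul_eq_mul, Function.comp]
  field_simp
  simp
  ring

variable {M : Type*} [TopologicalSpace M] [ChartedSpace (EuclideanSpace ℝ (Fin 2)) M]

lemma diff_comp {F G : Type*} [NormedAddCommGroup F] [NormedSpace ℝ F] [NormedAddCommGroup G]
    [NormedSpace ℝ G] {f : M → F} {g : F → G} {g' : F →L[ℝ] G} {p : M}
    (hg : HasFDerivAt g g' (f p)) (hf : MDifferentiableAt (𝓡 2) 𝓘(ℝ, F) f p) :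
    diff (fun q => g (f q)) p = g'.comp (diff f p) :=
  (hg.hasMFDerivAt.comp p hf.hasMFDerivAt).mfderiv

section

variable [IsManifold (𝓡 2) ∞ M]

/-- `diff` uses at each point the preferred chart of that point. Derivatives in the single chart at
`p` differ from it by a bijective linear map, the same for all functions `f`. -/
lemma exists_chart_jacobian (p : M) {x : EuclideanSpace ℝ (Fin 2)}
    (hx : x ∈ (extChartAt (𝓡 2) p).target) :
    ∃ J : EuclideanSpace ℝ (Fin 2) →L[ℝ] EuclideanSpace ℝ (Fin 2), Function.Bijective J ∧
      ∀ {F : Type} [NormedAddCommGroup F] [NormedSpace ℝ F] (f : M → F),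
        MDifferentiableAt (𝓡 2) 𝓘(ℝ, F) f ((extChartAt (𝓡 2) p).symm x) → ∀ v,
          fderiv ℝ (f ∘ (extChartAt (𝓡 2) p).symm) x v
            = diff f ((extChartAt (𝓡 2) p).symm x) (J v) := by
  have : IsManifold (𝓡 2) 1 M := IsManifold.of_le (n := ∞) (by norm_cast)
  have h1 := isInvertible_mfderivWithin_extChartAt_symm (I := 𝓡 2) hx
  have h2 := mdifferentiableWithinAt_extChartAt_symm (I := 𝓡 2) hx
  have hr : Set.range (𝓡 2) = Set.univ := ModelWithCorners.range_eq_univ _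
  rw [hr, mfderivWithin_univ] at h1
  rw [hr, mdifferentiableWithinAt_univ] at h2
  refine ⟨_, h1.bijective, fun f hf v => ?_⟩
  rw [← mfderiv_eq_fderiv, mfderiv_comp x hf h2]
  rfl

lemma contDiffOn_comp_extChartAt_symm {F : Type*} [NormedAddCommGroup F] [NormedSpace ℝ F]
    {f : M → F} {U : Set M} (hf : ContMDiffOn (𝓡 2) 𝓘(ℝ, F) ∞ f U) (p : M)
    {s : Set (EuclideanSpace ℝ (Fin 2))} (hs : s ⊆ (extChartAt (𝓡 2) p).target)
    (hU : ∀ x ∈ s, (extChartAt (𝓡 2) p).symm x ∈ U) :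
    ContDiffOn ℝ ∞ (f ∘ (extChartAt (𝓡 2) p).symm) s :=
  (hf.comp ((contMDiffOn_extChartAt_symm p).mono hs) hU).contDiffOn

omit [IsManifold (𝓡 2) ∞ M] in
lemma exists_chart_ball (p : M) {U : Set M} (hU : U ∈ 𝓝 p) :
    ∃ s : Set (EuclideanSpace ℝ (Fin 2)), IsOpen s ∧ Convex ℝ s ∧ extChartAt (𝓡 2) p p ∈ s ∧
      s ⊆ (extChartAt (𝓡 2) p).target ∧ (∀ x ∈ s, (extChartAt (𝓡 2) p).symm x ∈ U) ∧
      ∀ᶠ q in 𝓝 p, ∃ x ∈ s, (extChartAt (𝓡 2) p).symm x = q := by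
  have h1 : (extChartAt (𝓡 2) p).target ∩ (extChartAt (𝓡 2) p).symm ⁻¹' U
      ∈ 𝓝 (extChartAt (𝓡 2) p p) := by
    refine inter_mem (extChartAt_target_mem_nhds p) ?_
    apply (continuousAt_extChartAt_symm p).preimage_mem_nhds
    rwa [extChartAt_to_inv]
  obtain ⟨r, hr, hball⟩ := Metric.mem_nhds_iff.1 h1
  refine ⟨Metric.ball (extChartAt (𝓡 2) p p) r, Metric.isOpen_ball, convex_ball _ _,
    Metric.mem_ball_self hr, fun x hx => (hball hx).1, fun x hx => (hball hx).2, ?_⟩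
  filter_upwards [extChartAt_source_mem_nhds (I := 𝓡 2) p,
    (continuousAt_extChartAt (I := 𝓡 2) p).preimage_mem_nhds (Metric.ball_mem_nhds _ hr)]
    with q hq1 hq2
  exact ⟨extChartAt (𝓡 2) p q, hq2, (extChartAt (𝓡 2) p).left_inv hq1⟩

namespace IsMinimalSurface

variable {X n : M → E3} (hX : IsMinimalSurface X n)
include hX

omit [IsManifold (𝓡 2) ∞ M] in
lemma mdifferentiableAt (p : M) : MDifferentiableAt (𝓡 2) 𝓘(ℝ, E3) X p :=
  hX.smooth.mdifferentiable (by norm_num) p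

omit [IsManifold (𝓡 2) ∞ M] in
lemma mdifferentiableAt_normal (p : M) : MDifferentiableAt (𝓡 2) 𝓘(ℝ, E3) n p :=
  hX.smooth_normal.mdifferentiable (by norm_num) p

lemma inner_diff_normal (p : M) (v : EuclideanSpace ℝ (Fin 2)) :
    inner ℝ (n p) (diff n p v) = 0 := by
  have hp := mem_extChartAt_target (I := 𝓡 2) p
  have hU : ∀ᶠ y in 𝓝 (extChartAt (𝓡 2) p p), y ∈ (extChartAt (𝓡 2) p).target :=
    extChartAt_target_mem_nhds p
  obtain ⟨J, hJ, hd⟩ := exists_chart_jacobian p hp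
  obtain ⟨w, rfl⟩ := hJ.2 v
  have hn := (contDiffOn_comp_extChartAt_symm hX.smooth_normal.contMDiffOn p subset_rfl
    (U := Set.univ) (by simp)).contDiffAt hU
  have h := inner_fderiv_eq_zero_of_norm_eq_one (hn.differentiableAt (by norm_num))
    (Eventually.of_forall fun y => hX.norm_normal _) w
  rw [hd n (hX.mdifferentiableAt_normal _)] at h
  simpa [extChartAt_to_inv] using h

lemma inner_diff_symm (p : M) (v w : EuclideanSpace ℝ (Fin 2)) :
    inner ℝ (diff X p v) (diff n p w) = inner ℝ (diff X p w) (diff n p v) := by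
  have hp := mem_extChartAt_target (I := 𝓡 2) p
  have hU : ∀ᶠ y in 𝓝 (extChartAt (𝓡 2) p p), y ∈ (extChartAt (𝓡 2) p).target :=
    extChartAt_target_mem_nhds p
  obtain ⟨J, hJ, hd⟩ := exists_chart_jacobian p hp
  obtain ⟨v, rfl⟩ := hJ.2 v
  obtain ⟨w, rfl⟩ := hJ.2 w
  have hn := (contDiffOn_comp_extChartAt_symm hX.smooth_normal.contMDiffOn p subset_rfl
    (U := Set.univ) (by simp)).contDiffAt hU
  have hx := (contDiffOn_comp_extChartAt_symm hX.smooth.contMDiffOn p subset_rfl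
    (U := Set.univ) (by simp)).contDiffAt hU
  have h := inner_fderiv_symm (hx.of_le (by norm_cast)) (hn.differentiableAt (by norm_num)) (by
    filter_upwards [hU] with y hy v
    obtain ⟨J, hJ, hd⟩ := exists_chart_jacobian p hy
    rw [hd X (hX.mdifferentiableAt _)]
    exact hX.normal _ _) v w
  rw [hd n (hX.mdifferentiableAt_normal _), hd n (hX.mdifferentiableAt_normal _),
    hd X (hX.mdifferentiableAt _), hd X (hX.mdifferentiableAt _)] at h
  simpa [extChartAt_to_inv] using h

omit [IsManifold (𝓡 2) ∞ M] in
lemma diff_gaussMap {p : M} (h2 : n p 2 ≠ 1) (v : EuclideanSpace ℝ (Fin 2)) :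
    diff (gaussMap n) p v = dstereo (n p) (diff n p v) := by
  obtain ⟨L, hL, hLb⟩ := exists_hasFDerivAt_stereo h2
  rw [← hLb]
  have := diff_comp hL (hX.mdifferentiableAt_normal p)
  exact congrArg (fun T => T v) this

theorem exists_factor {p : M} (hK : gaussCurvature X n p < 0) (h2 : n p 2 ≠ 1) :
    ∃ F : ℂ, (∀ v, diff X p v = nullForm (gaussMap n p) (F * diff (gaussMap n) p v)) ∧
      Complex.normSq F * (1 + Complex.normSq (gaussMap n p)) ^ 4 * -gaussCurvature X n p = 16 := by
  obtain ⟨F, hF, hF'⟩ := exists_weierstrass (hX.norm_normal p) h2 (hX.normal p)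
    (hX.inner_diff_normal p) (hX.immersion p) (hX.inner_diff_symm p) (hX.minimal p) hK
  exact ⟨F, fun v => by rw [hF, hX.diff_gaussMap h2]; rfl, hF'⟩

end IsMinimalSurface

end

end Scherk

/-! ### The half turn exchanging `g` and `1 / g`, and the data near a point. -/

namespace Scherk
open Filter Topology

/-- The rotation by `π` about the first coordinate axis. -/
def halfTurn : E3 ≃ₗᵢ[ℝ] E3 :=
  LinearIsometryEquiv.piLpCongrRight 2
    ![LinearIsometryEquiv.refl ℝ ℝ, LinearIsometryEquiv.neg ℝ, LinearIsometryEquiv.neg ℝ]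

lemma halfTurn_zero (v : E3) : halfTurn v 0 = v 0 := by simp [halfTurn]
lemma halfTurn_one (v : E3) : halfTurn v 1 = -v 1 := by simp [halfTurn]
lemma halfTurn_two (v : E3) : halfTurn v 2 = -v 2 := by simp [halfTurn]

lemma halfTurn_halfTurn (v : E3) : halfTurn (halfTurn v) = v := by
  apply ext3 <;> simp [halfTurn_zero, halfTurn_one, halfTurn_two]

/-- The unit vector of the first coordinate plane with polar angle `τ`. -/
def equatorPoint (τ : ℝ) : E3 := !₂[Real.cos τ, Real.sin τ, 0]

lemma inner_equatorPoint (v : E3) (τ : ℝ) :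
    inner ℝ v (equatorPoint τ) = v 0 * Real.cos τ + v 1 * Real.sin τ := by
  rw [inner_eq]; simp [equatorPoint]

lemma inner_halfTurn_equatorPoint (v : E3) (τ : ℝ) :
    inner ℝ (halfTurn v) (equatorPoint τ) = inner ℝ v (equatorPoint (-τ)) := by
  rw [inner_equatorPoint, inner_equatorPoint, halfTurn_zero, halfTurn_one, Real.cos_neg,
    Real.sin_neg]
  ring

/-- For `e = e^{iτ}` one has `|g ± e|² = (1 + |g|²) (1 ± ⟨v, equatorPoint τ⟩)`; multiply the two
signs. -/
lemma normSq_sq_sub_exp {v : E3} (hv : ‖v‖ = 1) (h2 : v 2 ≠ 1) (τ : ℝ) :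
    Complex.normSq (stereo v ^ 2 - Complex.exp (2 * Complex.I * τ))
      = (1 + Complex.normSq (stereo v)) ^ 2 * (1 - inner ℝ v (equatorPoint τ) ^ 2) := by
  rw [inner_equatorPoint, stereo_coord0 hv h2, stereo_coord1 hv h2]
  set g := stereo v
  have hg := (one_add_normSq_pos g).ne'
  have h1 : g ^ 2 - Complex.exp (2 * Complex.I * τ) = (g - (Real.cos τ + Real.sin τ * Complex.I)) *
      (g + (Real.cos τ + Real.sin τ * Complex.I)) := by
    have : Complex.exp (2 * Complex.I * τ) = (Real.cos τ + Real.sin τ * Complex.I) ^ 2 := by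
      rw [Complex.ofReal_cos, Complex.ofReal_sin, ← Complex.exp_mul_I, ← Complex.exp_nat_mul]
      congr 1; push_cast; ring
    rw [this]; ring
  have hcs := Real.sin_sq_add_cos_sq τ
  have h3 : ∀ σ : ℝ, σ ^ 2 = 1 → Complex.normSq (g + σ * (Real.cos τ + Real.sin τ * Complex.I))
      = 1 + Complex.normSq g + σ * (2 * (g.re * Real.cos τ + g.im * Real.sin τ)) := by
    intro σ hσ
    rw [Complex.normSq_apply, Complex.normSq_apply]
    simp only [Complex.add_re, Complex.add_im, Complex.re_ofReal_mul, Complex.im_ofReal_mul,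
      Complex.ofReal_re, Complex.ofReal_im, Complex.I_re, Complex.I_im]
    linear_combination σ ^ 2 * hcs + hσ
  have h4 := h3 1 (by norm_num)
  have h5 := h3 (-1) (by norm_num)
  rw [h1, map_mul]
  have e4 : g + (Real.cos τ + Real.sin τ * Complex.I)
      = g + ((1 : ℝ) : ℂ) * (Real.cos τ + Real.sin τ * Complex.I) := by push_cast; ring
  have e5 : g - (Real.cos τ + Real.sin τ * Complex.I)
      = g + ((-1 : ℝ) : ℂ) * (Real.cos τ + Real.sin τ * Complex.I) := by push_cast; ring
  rw [e4, e5, h4, h5]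
  field_simp
  ring

lemma normSq_quartic {v : E3} (hv : ‖v‖ = 1) (h2 : v 2 ≠ 1) (θ : ℝ) :
    Complex.normSq (quartic θ (stereo v) 1) = (1 + Complex.normSq (stereo v)) ^ 4 *
      ((1 - inner ℝ v (equatorPoint θ) ^ 2) * (1 - inner ℝ v (equatorPoint (-θ)) ^ 2)) := by
  have h := normSq_sq_sub_exp hv h2 (-θ)
  rw [quartic, one_pow, mul_one, mul_one, map_mul, normSq_sq_sub_exp hv h2 θ,
    show -(2 * Complex.I * (θ : ℂ)) = 2 * Complex.I * ((-θ : ℝ) : ℂ) by push_cast; ring, h]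
  ring

lemma stereo_halfTurn {v : E3} (hv : ‖v‖ = 1) (h2 : v 2 ≠ 1) (h2' : v 2 ≠ -1) :
    stereo (halfTurn v) = (stereo v)⁻¹ := by
  have h3 : (1 - (v 2 : ℂ)) ≠ 0 := by
    rw [sub_ne_zero]; exact_mod_cast h2.symm
  have h3' : (1 + (v 2 : ℂ)) ≠ 0 := by
    intro h; apply h2'; have : 1 + v 2 = 0 := by rw [← Complex.ofReal_eq_zero]; push_cast; exact h
    linarith
  have h4 := norm_sq_eq v
  rw [hv] at h4
  have h5 : (1 : ℂ) ^ 2 = (v 0 : ℂ) ^ 2 + (v 1 : ℂ) ^ 2 + (v 2 : ℂ) ^ 2 := by exact_mod_cast h4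
  apply eq_inv_of_mul_eq_one_left
  rw [stereo, stereo, halfTurn_zero, halfTurn_one, halfTurn_two]
  push_cast
  rw [sub_neg_eq_add, div_mul_div_comm, div_eq_one_iff_eq (mul_ne_zero h3' h3)]
  linear_combination -h5 - (v 1 : ℂ) ^ 2 * Complex.I_sq

lemma stereo_ne_zero {v : E3} (hv : ‖v‖ = 1) (h2 : v 2 ≠ 1) (h2' : v 2 ≠ -1) : stereo v ≠ 0 := by
  intro h
  have := stereo_coord2 hv h2
  rw [h, map_zero] at this
  norm_num at this
  exact h2' this

lemma quartic_inv (θ : ℝ) {g : ℂ} (hg : g ≠ 0) : quartic θ g⁻¹ 1 = quartic θ g 1 / g ^ 4 := by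
  have h : Complex.exp (2 * Complex.I * θ) * Complex.exp (-(2 * Complex.I * θ)) = 1 := by
    rw [← Complex.exp_add, add_neg_cancel, Complex.exp_zero]
  rw [quartic, quartic]
  field_simp
  linear_combination (g ^ 4 - 1) * h

lemma quartic_swap (θ : ℝ) (a b : ℂ) : quartic θ a b = quartic θ b a := by
  have h : Complex.exp (2 * Complex.I * θ) * Complex.exp (-(2 * Complex.I * θ)) = 1 := by
    rw [← Complex.exp_add, add_neg_cancel, Complex.exp_zero]
  rw [quartic, quartic]
  linear_combination (b ^ 4 - a ^ 4) * h

lemma halfTurn_nullForm {g : ℂ} (hg : g ≠ 0) (η : ℂ) :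
    halfTurn (nullForm g η) = nullForm g⁻¹ (-g ^ 2 * η) := by
  apply ext3
  · rw [halfTurn_zero, nullForm_zero', nullForm_zero']
    congr 1; field_simp; ring
  · rw [halfTurn_one, nullForm_one', nullForm_one', ← Complex.neg_re]
    congr 1; field_simp; ring
  · rw [halfTurn_two, nullForm_two', nullForm_two', ← Complex.neg_re]
    congr 1; field_simp

lemma contDiffAt_stereo {v : E3} (h2 : v 2 ≠ 1) : ContDiffAt ℝ ∞ stereo v := by
  have hd : (1 - (v 2 : ℂ)) ≠ 0 := by
    rw [sub_ne_zero]; exact_mod_cast h2.symm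
  have hi : ∀ i : Fin 3, ContDiffAt ℝ ∞ (fun w : E3 => (w i : ℂ)) v := fun i =>
    (Complex.ofRealCLM.comp (EuclideanSpace.proj (𝕜 := ℝ) i)).contDiff.contDiffAt
  have h1 : ContDiffAt ℝ ∞ (fun w : E3 => (1 - (w 2 : ℂ))⁻¹) v :=
    (contDiffAt_const.sub (hi 2)).inv hd
  exact ((hi 0).add (contDiffAt_const.mul (hi 1))).mul h1

variable {M : Type*} [TopologicalSpace M] [ChartedSpace (EuclideanSpace ℝ (Fin 2)) M]

/-- At `p`, if the Gauss map is finite there, the surface has the Weierstrass data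
`dh / G = h dG / ((G² - e^{2iθ}) (G² - e^{-2iθ}))`. -/
def HasDataAt (θ : ℝ) (h : ℂ) (X n : M → E3) (p : M) : Prop :=
  n p 2 ≠ 1 → quartic θ (gaussMap n p) 1 ≠ 0 ∧ ∀ v, diff X p v =
    nullForm (gaussMap n p) (h / quartic θ (gaussMap n p) 1 * diff (gaussMap n) p v)

lemma diff_isometry {X : M → E3} {p : M} (hX : MDifferentiableAt (𝓡 2) 𝓘(ℝ, E3) X p)
    (R : E3 ≃ₗᵢ[ℝ] E3) (t : E3) (v : EuclideanSpace ℝ (Fin 2)) :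
    diff (fun q => R (X q) + t) p v = R (diff X p v) := by
  have h : HasFDerivAt (fun y => R y + t) (R.toContinuousLinearEquiv : E3 →L[ℝ] E3) (X p) :=
    (R.toContinuousLinearEquiv : E3 →L[ℝ] E3).hasFDerivAt.add_const t
  exact congrArg (fun T => T v) (diff_comp h hX)

namespace IsMinimalSurface

variable {X n : M → E3}

lemma diff_normal_isometry (hX : IsMinimalSurface X n) (R : E3 ≃ₗᵢ[ℝ] E3) (p : M)
    (v : EuclideanSpace ℝ (Fin 2)) : diff (fun q => R (n q)) p v = R (diff n p v) := by
  simpa using diff_isometry (hX.mdifferentiableAt_normal p) R 0 v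

lemma shapeOperator_isometry (hX : IsMinimalSurface X n) (R : E3 ≃ₗᵢ[ℝ] E3) (t : E3) (p : M) :
    shapeOperator (fun q => R (X q) + t) (fun q => R (n q)) p = shapeOperator X n p := by
  have h1 : firstForm (fun q => R (X q) + t) p = firstForm X p := by
    ext i j
    simp only [firstForm, Matrix.of_apply, diff_isometry (hX.mdifferentiableAt p),
      LinearIsometryEquiv.inner_map_map]
  have h2 : secondForm (fun q => R (X q) + t) (fun q => R (n q)) p = secondForm X n p := by
    ext i j
    simp only [secondForm, Matrix.of_apply, diff_isometry (hX.mdifferentiableAt p),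
      hX.diff_normal_isometry, LinearIsometryEquiv.inner_map_map]
  rw [shapeOperator, shapeOperator, h1, h2]

lemma gaussCurvature_isometry (hX : IsMinimalSurface X n) (R : E3 ≃ₗᵢ[ℝ] E3) (t : E3) (p : M) :
    gaussCurvature (fun q => R (X q) + t) (fun q => R (n q)) p = gaussCurvature X n p := by
  rw [gaussCurvature, gaussCurvature, hX.shapeOperator_isometry]

lemma isometry (hX : IsMinimalSurface X n) (R : E3 ≃ₗᵢ[ℝ] E3) (t : E3) :
    IsMinimalSurface (fun q => R (X q) + t) (fun q => R (n q)) where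
  smooth := (R.contDiff.add contDiff_const).contMDiff.comp hX.smooth
  immersion p v w h := by
    rw [diff_isometry (hX.mdifferentiableAt p), diff_isometry (hX.mdifferentiableAt p)] at h
    exact hX.immersion p (R.injective h)
  smooth_normal := R.contDiff.contMDiff.comp hX.smooth_normal
  norm_normal p := by rw [R.norm_map, hX.norm_normal]
  normal p v := by
    rw [diff_isometry (hX.mdifferentiableAt p), R.inner_map_map, hX.normal]
  minimal p := by
    rw [meanCurvature, hX.shapeOperator_isometry]; exact hX.minimal p

lemma mdifferentiableAt_gaussMap (hX : IsMinimalSurface X n) {p : M} (h2 : n p 2 ≠ 1) :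
    MDifferentiableAt (𝓡 2) 𝓘(ℝ, ℂ) (gaussMap n) p :=
  MDifferentiableAt.comp (g := stereo) p
    ((contDiffAt_stereo h2).differentiableAt (by norm_num)).mdifferentiableAt
    (hX.mdifferentiableAt_normal p)

lemma eventually_ne (hX : IsMinimalSurface X n) {p : M} {i : Fin 3} {c : ℝ} (h : n p i ≠ c) :
    ∀ᶠ q in 𝓝 p, n q i ≠ c :=
  ((EuclideanSpace.proj (𝕜 := ℝ) i).continuous.comp
    hX.smooth_normal.continuous).continuousAt.eventually_ne h

/-- The factors in `Q(1/g) = Q(g) / g⁴` and `d(1/g) = -dg / g²` combine to the `-g²` of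
`halfTurn_nullForm`, so the constant `h` is unchanged. -/
lemma hasDataAt_halfTurn (hX : IsMinimalSurface X n) {θ : ℝ} {h : ℂ} {p : M} (h2 : n p 2 ≠ 1)
    (h2' : n p 2 ≠ -1) (hp : HasDataAt θ h X n p) :
    HasDataAt θ h (fun q => halfTurn (X q)) (fun q => halfTurn (n q)) p := by
  intro _
  obtain ⟨hQ, hd⟩ := hp h2
  have hev : gaussMap (fun q => halfTurn (n q)) =ᶠ[𝓝 p] fun q => (gaussMap n q)⁻¹ := by
    filter_upwards [hX.eventually_ne h2, hX.eventually_ne h2'] with q hq hq'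
    exact stereo_halfTurn (hX.norm_normal q) hq hq'
  have hg : gaussMap n p ≠ 0 := stereo_ne_zero (hX.norm_normal p) h2 h2'
  have hdi : ∀ v, diff (gaussMap fun q => halfTurn (n q)) p v
      = -diff (gaussMap n) p v / gaussMap n p ^ 2 := by
    intro v
    have h1 : diff (gaussMap fun q => halfTurn (n q)) p = diff (fun q => (gaussMap n q)⁻¹) p :=
      hev.mfderiv_eq
    have h3 := diff_comp ((hasDerivAt_inv hg).hasFDerivAt.restrictScalars ℝ)
      (hX.mdifferentiableAt_gaussMap h2)
    rw [h1, h3]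
    simp [div_eq_mul_inv, mul_comm]
  rw [hev.self_of_nhds, quartic_inv θ hg]
  refine ⟨div_ne_zero hQ (pow_ne_zero 4 hg), fun v => ?_⟩
  have := diff_isometry (hX.mdifferentiableAt p) halfTurn 0 v
  simp only [add_zero] at this
  rw [this, hd, halfTurn_nullForm hg, hdi]
  congr 1
  field_simp

lemma hasDataAt_unique (hX : IsMinimalSurface X n) {θ : ℝ} {h h' : ℂ} {p : M} (h2 : n p 2 ≠ 1)
    (hp : HasDataAt θ h X n p) (hp' : HasDataAt θ h' X n p) : h = h' := by
  obtain ⟨hQ, hd⟩ := hp h2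
  obtain ⟨-, hd'⟩ := hp' h2
  set e : EuclideanSpace ℝ (Fin 2) := EuclideanSpace.single 0 1 with he
  have h1 : diff (gaussMap n) p e ≠ 0 := by
    intro h0
    have h3 : diff X p e = diff X p 0 := by
      rw [hd e, h0, mul_zero, map_zero]
      apply ext3 <;> simp [nullForm_coord0, nullForm_coord1, nullForm_coord2]
    have h4 := hX.immersion p h3
    simpa [he] using congrArg (fun v : EuclideanSpace ℝ (Fin 2) => v 0) h4
  have h3 := nullForm_injective _ ((hd e).symm.trans (hd' e))
  field_simp at h3
  exact h3

variable [IsManifold (𝓡 2) ∞ M]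

theorem eventually_hasDataAt (hX : IsMinimalSurface X n) (hK : ∀ p, gaussCurvature X n p < 0)
    {θ c : ℝ} (hc : 0 < c)
    (hC : ∀ p, (1 - inner ℝ (n p) (equatorPoint θ) ^ 2) *
      (1 - inner ℝ (n p) (equatorPoint (-θ)) ^ 2) ≠ 0 →
      (1 - inner ℝ (n p) (equatorPoint θ) ^ 2) * (1 - inner ℝ (n p) (equatorPoint (-θ)) ^ 2)
        = c * -gaussCurvature X n p) {p : M} (h2 : n p 2 ≠ 1) :
    ∃ h : ℂ, h ≠ 0 ∧ ∀ᶠ q in 𝓝 p, n q 2 ≠ 1 ∧ HasDataAt θ h X n q := by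
  obtain ⟨s, hso, hsc, hps, hst, hsU, hsp⟩ := exists_chart_ball p (hX.eventually_ne h2)
  -- The default `F = 0` at points with normal the north pole is harmless: the chart domain `s`
  -- avoids them.
  have hspec : ∀ q, ∃ F : ℂ, n q 2 ≠ 1 →
      (∀ v, diff X q v = nullForm (gaussMap n q) (F * diff (gaussMap n) q v)) ∧
      Complex.normSq F * (1 + Complex.normSq (gaussMap n q)) ^ 4 * -gaussCurvature X n q = 16 := by
    intro q
    by_cases hq : n q 2 ≠ 1
    · obtain ⟨F, hF⟩ := hX.exists_factor (hK q) hq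
      exact ⟨F, fun _ => hF⟩
    · exact ⟨0, fun h => absurd h hq⟩
  choose F hF using hspec
  set ψ := (extChartAt (𝓡 2) p).symm
  have hXs : ContDiffOn ℝ ∞ (X ∘ ψ) s :=
    contDiffOn_comp_extChartAt_symm hX.smooth.contMDiffOn p hst (U := Set.univ) (by simp)
  have hGs : ContDiffOn ℝ ∞ (gaussMap n ∘ ψ) s := by
    have h1 : ContDiffOn ℝ ∞ (n ∘ ψ) s :=
      contDiffOn_comp_extChartAt_symm hX.smooth_normal.contMDiffOn p hst (U := Set.univ) (by simp)
    intro x hx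
    exact ContDiffAt.comp_contDiffWithinAt (g := stereo) (f := n ∘ ψ) x
      (contDiffAt_stereo (hsU x hx)) (h1 x hx)
  have hW : ∀ x ∈ s, ∀ v, fderiv ℝ (X ∘ ψ) x v
      = nullForm ((gaussMap n ∘ ψ) x) ((F ∘ ψ) x * fderiv ℝ (gaussMap n ∘ ψ) x v) := by
    intro x hx v
    obtain ⟨J, hJ, hd⟩ := exists_chart_jacobian p (hst hx)
    rw [hd X (hX.mdifferentiableAt _), hd _ (hX.mdifferentiableAt_gaussMap (hsU x hx))]
    exact (hF _ (hsU x hx)).1 _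
  have hinj : ∀ x ∈ s, Function.Injective (fderiv ℝ (gaussMap n ∘ ψ) x) := by
    intro x hx
    obtain ⟨J, hJ, hd⟩ := exists_chart_jacobian p (hst hx)
    rw [injective_iff_map_eq_zero]
    intro v hv
    have h1 := hW x hx v
    rw [hv, mul_zero, hd X (hX.mdifferentiableAt _)] at h1
    have h3 : diff X (ψ x) (J v) = diff X (ψ x) (J 0) := by
      rw [h1, map_zero, map_zero]
      apply ext3 <;> simp [nullForm_coord0, nullForm_coord1, nullForm_coord2]
    exact hJ.1 (hX.immersion _ h3)
  -- `|Q|² = (1 + |g|²)⁴ c (-K)` and `|F|² (1 + |g|²)⁴ (-K) = 16` multiply to this constant.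
  have hnorm : ∀ q, n q 2 ≠ 1 → quartic θ (gaussMap n q) 1 ≠ 0 →
      Complex.normSq (F q * quartic θ (gaussMap n q) 1) = 16 * c := by
    intro q hq hQ
    have h1 : Complex.normSq (quartic θ (gaussMap n q) 1) = _ :=
      normSq_quartic (hX.norm_normal q) hq θ
    have h3 := hC q fun h0 => hQ (by
      rw [h0, mul_zero, Complex.normSq_eq_zero] at h1; exact h1)
    rw [h3] at h1
    rw [map_mul, h1, ← (hF q hq).2]
    change _ * ((1 + Complex.normSq (gaussMap n q)) ^ 4 * _) = _
    ring
  obtain ⟨hQ, hconst⟩ := weierstrass_factor_const hso hsc.isPreconnected hXs hGs hW hinj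
    (θ := θ) (c := 16 * c) (by positivity) (fun x hx => hnorm _ (hsU x hx))
  refine ⟨F p * quartic θ (gaussMap n p) 1, ?_, ?_⟩
  · have h0 : ψ (extChartAt (𝓡 2) p p) = p := extChartAt_to_inv p
    have h1 := hQ _ hps
    rw [Function.comp, h0] at h1
    intro h3
    have h4 := hnorm p h2 h1
    rw [h3, map_zero] at h4
    linarith
  · filter_upwards [hsp] with q ⟨x, hx, hxq⟩
    have hq := hsU x hx
    have hQx := hQ x hx
    have hcx := hconst x hx _ hps
    have h0 : ψ (extChartAt (𝓡 2) p p) = p := extChartAt_to_inv p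
    simp only [Function.comp, hxq, h0] at hQx hcx
    change n (ψ x) 2 ≠ 1 at hq
    rw [hxq] at hq
    refine ⟨hq, fun _ => ⟨hQx, fun v => ?_⟩⟩
    rw [(hF q hq).1, ← hcx]
    congr 1
    field_simp

end IsMinimalSurface

end Scherk

/-! ### The model surface: homogeneous coordinates, concatenation and existence of paths. -/

namespace Scherk
open Filter Topology

lemma scherkForm_finite (θ ρ Θ : ℝ) (g dg : ℂ) :
    scherkForm θ ρ Θ g 1 dg 0
      = nullForm g (ρ * Complex.exp (Complex.I * Θ) / quartic θ g 1 * dg) := by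
  apply ext3 <;> simp only [scherkForm, nullForm] <;>
    simp only [Matrix.cons_val_zero, Matrix.cons_val_one, Matrix.cons_val] <;>
    congr 1 <;> ring

lemma scherkForm_infinite (θ ρ Θ : ℝ) (g dg : ℂ) :
    scherkForm θ ρ Θ 1 g 0 dg
      = halfTurn (nullForm g (ρ * Complex.exp (Complex.I * Θ) / quartic θ g 1 * dg)) := by
  apply ext3 <;> simp only [halfTurn_zero, halfTurn_one, halfTurn_two, ← Complex.neg_re,
    nullForm_zero', nullForm_one', nullForm_two'] <;>
    simp only [scherkForm, quartic_swap θ 1 g, PiLp.toLp_apply, Matrix.cons_val_zero,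
      Matrix.cons_val_one, Matrix.cons_val] <;>
    congr 1 <;> ring

lemma quartic_smul (θ : ℝ) (l a b : ℂ) : quartic θ (l * a) (l * b) = l ^ 4 * quartic θ a b := by
  rw [quartic, quartic]; ring

/-- The quadratic coefficients and `b da - a db` both have degree two, which the quartic cancels. -/
lemma scherkForm_homogeneous (θ ρ Θ : ℝ) {l : ℂ} (hl : l ≠ 0) (a b da db : ℂ) :
    scherkForm θ ρ Θ (l * a) (l * b) (l * da) (l * db) = scherkForm θ ρ Θ a b da db := by
  apply ext3 <;> simp only [scherkForm, quartic_smul, PiLp.toLp_apply, Matrix.cons_val_zero,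
      Matrix.cons_val_one, Matrix.cons_val] <;>
    congr 1 <;> field_simp

lemma scherkForm_real_smul (θ ρ Θ c : ℝ) (a b da db : ℂ) :
    scherkForm θ ρ Θ a b (c * da) (c * db) = c • scherkForm θ ρ Θ a b da db := by
  apply ext3 <;> simp only [scherkForm, PiLp.toLp_apply, Matrix.cons_val_zero,
      Matrix.cons_val_one, Matrix.cons_val, PiLp.smul_apply, smul_eq_mul,
      ← Complex.re_ofReal_mul] <;>
    congr 1 <;> ring

lemma spherePoint_homogeneous {l : ℂ} (hl : l ≠ 0) (a b : ℂ) :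
    spherePoint (l * a) (l * b) = spherePoint a b := by
  have h : l * a * starRingEnd ℂ (l * b) = ((‖l‖ ^ 2 : ℝ) : ℂ) * (a * starRingEnd ℂ b) := by
    rw [← Complex.normSq_eq_norm_sq, ← Complex.mul_conj, map_mul]; ring
  have hl' : ‖l‖ ≠ 0 := norm_ne_zero_iff.2 hl
  have e : (‖l * a‖ ^ 2 + ‖l * b‖ ^ 2)⁻¹ = (‖a‖ ^ 2 + ‖b‖ ^ 2)⁻¹ * (‖l‖ ^ 2)⁻¹ := by
    rw [norm_mul, norm_mul, mul_pow, mul_pow, ← mul_add, mul_inv, mul_comm]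
  rw [spherePoint, spherePoint, h, e, Complex.re_ofReal_mul, Complex.im_ofReal_mul, norm_mul,
    norm_mul]
  apply ext3 <;> simp only [PiLp.smul_apply, smul_eq_mul, Matrix.cons_val_zero,
      Matrix.cons_val_one, Matrix.cons_val] <;> field_simp

lemma spherePoint_stereo {v : E3} (hv : ‖v‖ = 1) (h2 : v 2 ≠ 1) :
    spherePoint (stereo v) 1 = v := by
  have h0 := stereo_coord0 hv h2
  have h1 := stereo_coord1 hv h2
  have h3 := stereo_coord2 hv h2
  rw [spherePoint, ← Complex.normSq_eq_norm_sq]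
  apply ext3 <;> simp only [PiLp.smul_apply, smul_eq_mul, Matrix.cons_val_zero,
      Matrix.cons_val_one, Matrix.cons_val, map_one, mul_one, norm_one, one_pow]
  · rw [h0]; ring
  · rw [h1]; ring
  · rw [h3]; ring

lemma spherePoint_swap (a b : ℂ) : spherePoint b a = halfTurn (spherePoint a b) := by
  have h : b * starRingEnd ℂ a = starRingEnd ℂ (a * starRingEnd ℂ b) := by
    rw [map_mul, Complex.conj_conj, mul_comm]
  apply ext3 <;> simp only [halfTurn_zero, halfTurn_one, halfTurn_two, spherePoint, h,
    Complex.conj_re, Complex.conj_im, PiLp.smul_apply, smul_eq_mul,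
    Matrix.cons_val_zero, Matrix.cons_val_one, Matrix.cons_val] <;> ring

lemma ne_zero_of_quartic {θ : ℝ} {a b : ℂ} (h : quartic θ a b ≠ 0) :
    0 < ‖a‖ ^ 2 + ‖b‖ ^ 2 := by
  by_contra! h0
  have ha : a = 0 := norm_eq_zero.1 (by nlinarith [sq_nonneg ‖a‖, sq_nonneg ‖b‖])
  have hb : b = 0 := norm_eq_zero.1 (by nlinarith [sq_nonneg ‖a‖, sq_nonneg ‖b‖])
  exact h (by rw [quartic, ha, hb]; ring)

/-- Two paths meeting on the sphere may have different homogeneous coordinates there; the scalar `l`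
makes their lifts match, so that they can be concatenated. -/
lemma exists_scale_of_spherePoint_eq {a b a' b' : ℂ} (h : 0 < ‖a‖ ^ 2 + ‖b‖ ^ 2)
    (h' : 0 < ‖a'‖ ^ 2 + ‖b'‖ ^ 2) (he : spherePoint a b = spherePoint a' b') :
    ∃ l : ℂ, l ≠ 0 ∧ a = l * a' ∧ b = l * b' := by
  have e0 := congrArg (fun v : E3 => v 0) he
  have e1 := congrArg (fun v : E3 => v 1) he
  have e2 := congrArg (fun v : E3 => v 2) he
  simp only [spherePoint, PiLp.smul_apply, smul_eq_mul, Matrix.cons_val_zero,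
      Matrix.cons_val_one, Matrix.cons_val] at e0 e1 e2
  have hb2 : ‖b‖ ^ 2 * (‖a'‖ ^ 2 + ‖b'‖ ^ 2) = ‖b'‖ ^ 2 * (‖a‖ ^ 2 + ‖b‖ ^ 2) := by
    field_simp at e2; linarith
  have hu : a * starRingEnd ℂ b * ((‖a'‖ ^ 2 + ‖b'‖ ^ 2 : ℝ) : ℂ)
      = a' * starRingEnd ℂ b' * ((‖a‖ ^ 2 + ‖b‖ ^ 2 : ℝ) : ℂ) := by
    rw [mul_comm _ ((_ : ℝ) : ℂ), mul_comm _ ((_ : ℝ) : ℂ)]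
    apply Complex.ext
    · rw [Complex.re_ofReal_mul, Complex.re_ofReal_mul]; field_simp at e0; linarith
    · rw [Complex.im_ofReal_mul, Complex.im_ofReal_mul]; field_simp at e1; linarith
  by_cases hb : b = 0
  · subst hb
    have hb' : b' = 0 := by
      rw [norm_zero] at hb2 h
      have : ‖b'‖ ^ 2 = 0 := by
        rcases mul_eq_zero.1 (show ‖b'‖ ^ 2 * (‖a‖ ^ 2 + 0 ^ 2) = 0 by linarith) with h3 | h3
        · exact h3
        · exact absurd h3 h.ne'
      exact norm_eq_zero.1 (pow_eq_zero_iff (by norm_num) |>.1 this)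
    subst hb'
    have ha : a ≠ 0 := by rintro rfl; simp at h
    have ha' : a' ≠ 0 := by rintro rfl; simp at h'
    exact ⟨a / a', div_ne_zero ha ha', by field_simp, by simp⟩
  · have hb' : b' ≠ 0 := by
      rintro rfl
      rw [norm_zero] at hb2
      have : ‖b‖ ≠ 0 := norm_ne_zero_iff.2 hb
      have h3 : 0 < ‖b‖ ^ 2 * (‖a'‖ ^ 2 + ‖(0 : ℂ)‖ ^ 2) := by positivity
      rw [norm_zero] at h3
      linarith
    refine ⟨b / b', div_ne_zero hb hb', ?_, by field_simp⟩
    have hbC : b * starRingEnd ℂ b * ((‖a'‖ ^ 2 + ‖b'‖ ^ 2 : ℝ) : ℂ)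
        = b' * starRingEnd ℂ b' * ((‖a‖ ^ 2 + ‖b‖ ^ 2 : ℝ) : ℂ) := by
      rw [Complex.mul_conj, Complex.mul_conj, Complex.normSq_eq_norm_sq, Complex.normSq_eq_norm_sq]
      exact_mod_cast hb2
    have hD : ((‖a‖ ^ 2 + ‖b‖ ^ 2 : ℝ) : ℂ) ≠ 0 := by exact_mod_cast h.ne'
    have hD' : ((‖a'‖ ^ 2 + ‖b'‖ ^ 2 : ℝ) : ℂ) ≠ 0 := by exact_mod_cast h'.ne'
    have hcb : starRingEnd ℂ b ≠ 0 := by simpa using hb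
    have hcb' : starRingEnd ℂ b' ≠ 0 := by simpa using hb'
    rw [div_mul_eq_mul_div, eq_div_iff hb']
    apply mul_right_cancel₀ (mul_ne_zero hcb (mul_ne_zero hD' (mul_ne_zero hcb' hD)))
    linear_combination (b' * starRingEnd ℂ b' * ((‖a‖ ^ 2 + ‖b‖ ^ 2 : ℝ) : ℂ)) * hu -
      (a' * starRingEnd ℂ b' * ((‖a‖ ^ 2 + ‖b‖ ^ 2 : ℝ) : ℂ)) * hbC

/-- Concatenation of two paths on the unit interval. -/
def concat {F : Type*} (f g : ℝ → F) (t : ℝ) : F :=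
  if t ≤ 1 / 2 then f (2 * t) else g (2 * t - 1)

lemma concat_zero {F : Type*} (f g : ℝ → F) : concat f g 0 = f 0 := by simp [concat]

lemma concat_one {F : Type*} (f g : ℝ → F) : concat f g 1 = g 1 := by norm_num [concat]

lemma concat_of_le {F : Type*} (f g : ℝ → F) {t : ℝ} (ht : t ≤ 1 / 2) :
    concat f g t = f (2 * t) := by simp only [concat, if_pos ht]

lemma concat_of_lt {F : Type*} (f g : ℝ → F) {t : ℝ} (ht : 1 / 2 < t) :
    concat f g t = g (2 * t - 1) := by simp only [concat, if_neg ht.not_ge]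

lemma continuousOn_concat {F : Type*} [TopologicalSpace F] {f g : ℝ → F}
    (hf : ContinuousOn f (Set.Icc 0 1)) (hg : ContinuousOn g (Set.Icc 0 1)) (h : f 1 = g 0) :
    ContinuousOn (concat f g) (Set.Icc 0 1) := by
  have h1 : ContinuousOn (concat f g) (Set.Icc 0 (1 / 2)) := by
    refine (hf.comp (f := fun t => 2 * t) (by fun_prop) fun t ht => ?_).congr fun t ht =>
      concat_of_le f g ht.2
    exact ⟨by linarith [ht.1], by linarith [ht.2]⟩
  have h2 : ContinuousOn (concat f g) (Set.Icc (1 / 2) 1) := by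
    refine (hg.comp (f := fun t => 2 * t - 1) (by fun_prop) fun t ht => ?_).congr fun t ht => ?_
    · exact ⟨by linarith [ht.1], by linarith [ht.2]⟩
    · rcases ht.1.eq_or_lt with h3 | h3
      · rw [concat_of_le f g h3.ge, ← h3]; norm_num; exact h
      · exact concat_of_lt f g h3
  have h3 := h1.union_of_isClosed h2 isClosed_Icc isClosed_Icc
  rwa [Set.Icc_union_Icc_eq_Icc (by norm_num) (by norm_num)] at h3

lemma hasDerivAt_concat_left {F : Type*} [NormedAddCommGroup F] [NormedSpace ℝ F] {f g : ℝ → F}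
    {t : ℝ} {f' : F} (ht : t < 1 / 2) (hf : HasDerivAt f f' (2 * t)) :
    HasDerivAt (concat f g) ((2 : ℝ) • f') t := by
  have h1 : HasDerivAt (fun t : ℝ => 2 * t) 2 t := by simpa using (hasDerivAt_id t).const_mul 2
  refine (hf.scomp t h1).congr_of_eventuallyEq ?_
  filter_upwards [gt_mem_nhds ht] with u hu using concat_of_le f g hu.le

lemma hasDerivAt_concat_right {F : Type*} [NormedAddCommGroup F] [NormedSpace ℝ F] {f g : ℝ → F}
    {t : ℝ} {g' : F} (ht : 1 / 2 < t) (hg : HasDerivAt g g' (2 * t - 1)) :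
    HasDerivAt (concat f g) ((2 : ℝ) • g') t := by
  have h1 : HasDerivAt (fun t : ℝ => 2 * t - 1) 2 t := by
    simpa using ((hasDerivAt_id t).const_mul 2).sub_const 1
  refine (hg.scomp t h1).congr_of_eventuallyEq ?_
  filter_upwards [lt_mem_nhds ht] with u hu using concat_of_lt f g hu

lemma scherkSurface_extend {θ ρ Θ : ℝ} {a b : ℝ → ℂ} {y : ℝ → E3}
    (ha : ContinuousOn a (Set.Icc 0 1)) (hb : ContinuousOn b (Set.Icc 0 1))
    (hy : ContinuousOn y (Set.Icc 0 1)) (hQ : ∀ t ∈ Set.Icc (0 : ℝ) 1, quartic θ (a t) (b t) ≠ 0)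
    (hd : ∀ t ∈ Set.Ioo (0 : ℝ) 1, DifferentiableAt ℝ a t ∧ DifferentiableAt ℝ b t ∧
      HasDerivAt y (scherkForm θ ρ Θ (a t) (b t) (deriv a t) (deriv b t)) t)
    (h0 : (y 0, spherePoint (a 0) (b 0)) ∈ scherkSurface θ ρ Θ) :
    (y 1, spherePoint (a 1) (b 1)) ∈ scherkSurface θ ρ Θ := by
  obtain ⟨a', b', y', s, ha', hb', hy', hQ', hd', ha0, hy0, hq⟩ := h0
  have hq1 : y 0 = y' 1 := congrArg Prod.fst hq
  have hq2 : spherePoint (a' 1) (b' 1) = spherePoint (a 0) (b 0) := (congrArg Prod.snd hq).symm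
  obtain ⟨l, hl, hla, hlb⟩ := exists_scale_of_spherePoint_eq
    (ne_zero_of_quartic (hQ' 1 (by simp))) (ne_zero_of_quartic (hQ 0 (by simp))) hq2
  refine ⟨concat a' fun t => l * a t, concat b' fun t => l * b t, concat y' y,
    -- The exceptional parameters are the junction and the old ones, halved by the
    -- reparametrization.
    insert (1 / 2) (s.image fun t => t / 2),
    continuousOn_concat ha' (continuousOn_const.mul ha) hla,
    continuousOn_concat hb' (continuousOn_const.mul hb) hlb, continuousOn_concat hy' hy hq1.symm,
    ?_, ?_, ?_, ?_, ?_⟩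
  · intro t ht
    rcases le_or_gt t (1 / 2) with h | h
    · rw [concat_of_le _ _ h, concat_of_le _ _ h]
      exact hQ' _ ⟨by linarith [ht.1], by linarith⟩
    · rw [concat_of_lt _ _ h, concat_of_lt _ _ h, quartic_smul]
      exact mul_ne_zero (pow_ne_zero 4 hl) (hQ _ ⟨by linarith, by linarith [ht.2]⟩)
  · intro t ht hts
    rw [Finset.mem_insert, not_or, Finset.mem_image] at hts
    rcases lt_or_gt_of_ne hts.1 with h | h
    · obtain ⟨d1, d2, d3⟩ := hd' (2 * t) ⟨by linarith [ht.1], by linarith⟩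
        fun hm => hts.2 ⟨2 * t, hm, by ring⟩
      have e1 := hasDerivAt_concat_left (g := fun t => l * a t) h d1.hasDerivAt
      have e2 := hasDerivAt_concat_left (g := fun t => l * b t) h d2.hasDerivAt
      have e3 := hasDerivAt_concat_left (g := y) h d3
      refine ⟨e1.differentiableAt, e2.differentiableAt, ?_⟩
      rw [e1.deriv, e2.deriv, concat_of_le _ _ h.le, concat_of_le _ _ h.le, Complex.real_smul,
        Complex.real_smul, scherkForm_real_smul]
      exact e3
    · obtain ⟨d1, d2, d3⟩ := hd (2 * t - 1) ⟨by linarith, by linarith [ht.2]⟩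
      have e1 := hasDerivAt_concat_right (f := a') h (d1.hasDerivAt.const_mul l)
      have e2 := hasDerivAt_concat_right (f := b') h (d2.hasDerivAt.const_mul l)
      have e3 := hasDerivAt_concat_right (f := y') h d3
      refine ⟨e1.differentiableAt, e2.differentiableAt, ?_⟩
      rw [e1.deriv, e2.deriv, concat_of_lt _ _ h, concat_of_lt _ _ h, Complex.real_smul,
        Complex.real_smul, scherkForm_real_smul, scherkForm_homogeneous _ _ _ hl]
      exact e3
  · rw [concat_zero, ha0]
  · rw [concat_zero, hy0]
  · rw [concat_one, concat_one, concat_one, spherePoint_homogeneous hl]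

lemma exists_factor_of_quartic_eq_zero (θ : ℝ) :
    ∃ S : Finset ℂ, (∀ e ∈ S, e ≠ 0) ∧ ∀ a b, quartic θ a b = 0 ↔ ∃ e ∈ S, a = e * b := by
  set E := Complex.exp (Complex.I * θ) with hE
  set E' := Complex.exp (-(Complex.I * θ)) with hE'
  have h1 : Complex.exp (2 * Complex.I * θ) = E ^ 2 := by
    rw [hE, ← Complex.exp_nat_mul]; congr 1; push_cast; ring
  have h2 : Complex.exp (-(2 * Complex.I * θ)) = E' ^ 2 := by
    rw [hE', ← Complex.exp_nat_mul]; congr 1; push_cast; ring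
  have h3 : E ≠ 0 := Complex.exp_ne_zero _
  have h4 : E' ≠ 0 := Complex.exp_ne_zero _
  refine ⟨{E, -E, E', -E'}, by simp [h3, h4], fun a b => ?_⟩
  rw [quartic, h1, h2, mul_eq_zero, ← mul_pow, ← mul_pow, sub_eq_zero, sub_eq_zero,
    sq_eq_sq_iff_eq_or_eq_neg, sq_eq_sq_iff_eq_or_eq_neg]
  simp [or_assoc]

lemma continuousOn_scherkForm {θ ρ Θ : ℝ} {a b : ℝ → ℂ} {u : Set ℝ} (ha : ContinuousOn a u)
    (hb : ContinuousOn b u) (hQ : ∀ t ∈ u, quartic θ (a t) (b t) ≠ 0) (da db : ℂ) :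
    ContinuousOn (fun t => scherkForm θ ρ Θ (a t) (b t) da db) u := by
  have hQc : ContinuousOn (fun t => quartic θ (a t) (b t)) u := by
    unfold quartic; fun_prop
  have hη : ContinuousOn (fun t => ρ * Complex.exp (Complex.I * Θ) * (b t * da - a t * db) /
      quartic θ (a t) (b t)) u := ContinuousOn.div (by fun_prop) hQc hQ
  unfold scherkForm
  refine (PiLp.continuous_toLp 2 _).comp_continuousOn (continuousOn_pi.2 fun i => ?_)
  fin_cases i
  · exact Complex.continuous_re.comp_continuousOn (ContinuousOn.mul (by fun_prop) hη)
  · exact Complex.continuous_re.comp_continuousOn (ContinuousOn.mul (by fun_prop) hη)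
  · exact Complex.continuous_re.comp_continuousOn (ContinuousOn.mul (by fun_prop) hη)

/-- Every point of the Riemann sphere other than the four poles is the normal of some point of the
Scherk surface. -/
lemma exists_mem_scherkSurface {θ : ℝ} (ρ Θ : ℝ) {a b : ℂ} (h : quartic θ a b ≠ 0) :
    ∃ y : E3, (y, spherePoint a b) ∈ scherkSurface θ ρ Θ := by
  obtain ⟨S, hS0, hS⟩ := exists_factor_of_quartic_eq_zero θ
  -- The path is the segment in `ℂ²` from `(0, μ)` to `(a, b)`. Before its end it meets the line `a
  -- = e b` of a pole only if `μ` is a real multiple of `(a - e * b) / e`. A slope `k` of `μ`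
  -- outside finitely many values excludes this.
  obtain ⟨k, hk⟩ := (S.image fun e => ((a - e * b) / e).im / ((a - e * b) / e).re).exists_notMem
  set μ : ℂ := 1 + k * Complex.I with hμ
  set α : ℝ → ℂ := fun t => t * a with hα
  set β : ℝ → ℂ := fun t => (1 - t) * μ + t * b with hβ
  have hαc : Continuous α := by fun_prop
  have hβc : Continuous β := by fun_prop
  have hQ : ∀ t ∈ Set.Icc (0 : ℝ) 1, quartic θ (α t) (β t) ≠ 0 := by
    intro t ht h0
    obtain ⟨e, he, hab⟩ := (hS _ _).1 h0
    rcases ht.2.eq_or_lt with rfl | h1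
    · apply h
      rw [hS]
      exact ⟨e, he, by simpa [hα, hβ] using hab⟩
    · have he0 := hS0 e he
      have h1' : (1 - t) ≠ 0 := by linarith
      have h1C : (1 - (t : ℂ)) ≠ 0 := by exact_mod_cast h1'
      have h3 : μ = ((t / (1 - t) : ℝ) : ℂ) * ((a - e * b) / e) := by
        push_cast
        field_simp
        simp only [hα, hβ] at hab
        linear_combination -hab
      apply hk
      rw [Finset.mem_image]
      refine ⟨e, he, ?_⟩
      have hre := congrArg Complex.re h3
      have him := congrArg Complex.im h3
      rw [Complex.re_ofReal_mul] at hre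
      rw [Complex.im_ofReal_mul] at him
      simp [hμ] at hre him
      have hw : ((a - e * b) / e).re ≠ 0 := by
        intro h0; rw [h0, mul_zero] at hre; exact one_ne_zero hre
      rw [div_eq_iff hw, him]
      linear_combination ((a - e * b) / e).im * hre
  -- Clamping the parameter to `[0, 1]` makes the integrand continuous on all of `ℝ`, so its
  -- primitive is differentiable everywhere.
  have hfc : Continuous fun t : ℝ => scherkForm θ ρ Θ (α (max 0 (min 1 t))) (β (max 0 (min 1 t)))
      a (b - μ) :=
    (continuousOn_scherkForm hαc.continuousOn hβc.continuousOn hQ a (b - μ)).comp_continuous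
      (f := fun t : ℝ => max 0 (min 1 t)) (by fun_prop) fun t => ⟨le_max_left _ _, by simp⟩
  obtain ⟨y, hy0, hyd⟩ : ∃ y : ℝ → E3, y 0 = 0 ∧ ∀ t, HasDerivAt y
      (scherkForm θ ρ Θ (α (max 0 (min 1 t))) (β (max 0 (min 1 t))) a (b - μ)) t :=
    ⟨_, intervalIntegral.integral_same, fun t => (hfc.integral_hasStrictDerivAt 0 t).hasDerivAt⟩
  refine ⟨y 1, α, β, y, ∅, hαc.continuousOn, hβc.continuousOn,
    fun t _ => (hyd t).continuousAt.continuousWithinAt, hQ, fun t ht _ => ?_, by simp [hα],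
    hy0, ?_⟩
  · have h1 : HasDerivAt α a t := by
      simpa [hα] using (Complex.ofRealCLM.hasDerivAt (x := t)).mul_const a
    have h2 : HasDerivAt β (b - μ) t := by
      have := (((Complex.ofRealCLM.hasDerivAt (x := t)).const_sub 1).mul_const μ).add
        ((Complex.ofRealCLM.hasDerivAt (x := t)).mul_const b)
      refine HasDerivAt.congr_deriv this ?_
      simp; ring
    refine ⟨h1.differentiableAt, h2.differentiableAt, ?_⟩
    rw [h1.deriv, h2.deriv]
    have h3 := hyd t
    rwa [min_eq_right ht.2.le, max_eq_right ht.1.le] at h3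
  · simp [hα, hβ]

end Scherk

/-! ### Normalizing `V₁` and `V₂` by a rotation. -/

namespace Scherk
open Filter Topology

/-- For unit vectors the sum and the difference are orthogonal; normalized, they are the first two
basis vectors. If `c = 0` the sum vanishes and only `b 1` is prescribed. -/
lemma exists_orthonormalBasis_of_norm_eq_one {V₁ V₂ : E3} (h1 : ‖V₁‖ = 1) (h2 : ‖V₂‖ = 1)
    {c s : ℝ} (hs : 0 < s) (hcs : c ^ 2 + s ^ 2 = 1) (hc : inner ℝ V₁ V₂ = c ^ 2 - s ^ 2) :
    ∃ b : OrthonormalBasis (Fin 3) ℝ E3, V₁ = c • b 0 + s • b 1 ∧ V₂ = c • b 0 - s • b 1 := by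
  have n1 : inner ℝ V₁ V₁ = (1 : ℝ) := by rw [real_inner_self_eq_norm_sq, h1, one_pow]
  have n2 : inner ℝ V₂ V₂ = (1 : ℝ) := by rw [real_inner_self_eq_norm_sq, h2, one_pow]
  have hc' : inner ℝ V₂ V₁ = c ^ 2 - s ^ 2 := by rw [real_inner_comm, hc]
  have hsub : ‖(2 * s)⁻¹ • (V₁ - V₂)‖ = 1 := by
    rw [← sq_eq_sq₀ (norm_nonneg _) zero_le_one, ← real_inner_self_eq_norm_sq]
    simp only [inner_smul_left, inner_smul_right, inner_sub_left, inner_sub_right, n1, n2, hc, hc',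
      RCLike.conj_to_real]
    field_simp
    linear_combination -2 * hcs
  by_cases hc0 : c = 0
  · subst hc0
    have hV : V₁ = -V₂ := by
      rw [← sub_eq_zero, sub_neg_eq_add, ← inner_self_eq_zero (𝕜 := ℝ)]
      simp only [inner_add_left, inner_add_right, n1, n2, hc, hc']
      linear_combination -2 * hcs
    have hs1 : s = 1 := by nlinarith
    obtain ⟨b, hb⟩ := Orthonormal.exists_orthonormalBasis_extension_of_card_eq (𝕜 := ℝ) (E := E3)
      (ι := Fin 3) (by simp) (v := fun _ => V₁) (s := {1}) (by
        refine ⟨fun i => h1, fun i j hij => absurd (Subsingleton.elim i j) hij⟩)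
    refine ⟨b, ?_, ?_⟩
    · rw [hb 1 rfl, hs1]; simp
    · rw [hb 1 rfl, hs1, hV]; simp
  · have hadd : ‖(2 * c)⁻¹ • (V₁ + V₂)‖ = 1 := by
      rw [← sq_eq_sq₀ (norm_nonneg _) zero_le_one, ← real_inner_self_eq_norm_sq]
      simp only [inner_smul_left, inner_smul_right, inner_add_left, inner_add_right, n1, n2, hc,
        hc', RCLike.conj_to_real]
      field_simp
      linear_combination -2 * hcs
    have horth : inner ℝ ((2 * c)⁻¹ • (V₁ + V₂)) ((2 * s)⁻¹ • (V₁ - V₂)) = (0 : ℝ) := by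
      simp only [inner_smul_left, inner_smul_right, inner_add_left, inner_sub_right, n1, n2, hc,
        hc']
      ring
    obtain ⟨b, hb⟩ := Orthonormal.exists_orthonormalBasis_extension_of_card_eq (𝕜 := ℝ) (E := E3)
      (ι := Fin 3) (by simp)
      (v := ![(2 * c)⁻¹ • (V₁ + V₂), (2 * s)⁻¹ • (V₁ - V₂), 0]) (s := {0, 1}) (by
        constructor
        · rintro ⟨i, rfl | rfl⟩
          · exact hadd
          · exact hsub
        · rintro ⟨i, rfl | rfl⟩ ⟨j, rfl | rfl⟩ hij
          · exact absurd rfl hij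
          · exact horth
          · exact (real_inner_comm _ _).trans horth
          · exact absurd rfl hij)
    have b0 : b 0 = (2 * c)⁻¹ • (V₁ + V₂) := hb 0 (by simp)
    have b1 : b 1 = (2 * s)⁻¹ • (V₁ - V₂) := hb 1 (by simp)
    have e0 : c • b 0 = (2 : ℝ)⁻¹ • (V₁ + V₂) := by
      rw [b0, smul_smul]; congr 1; field_simp
    have e1 : s • b 1 = (2 : ℝ)⁻¹ • (V₁ - V₂) := by
      rw [b1, smul_smul]; congr 1; field_simp
    refine ⟨b, ?_, ?_⟩ <;> rw [e0, e1] <;> module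

/-- If the determinant is `-1`, compose with the reflection in the plane of the first two
coordinates, which fixes the images that matter. -/
lemma exists_isometry_det_eq_one (R : E3 ≃ₗᵢ[ℝ] E3) :
    ∃ R' : E3 ≃ₗᵢ[ℝ] E3, LinearMap.det (R'.toLinearEquiv : E3 →ₗ[ℝ] E3) = 1 ∧
      ∀ v, R v 2 = 0 → R' v = R v := by
  have h1 : |LinearMap.det (R.toLinearEquiv : E3 →ₗ[ℝ] E3)| = 1 := by
    rw [← LinearMap.normDet_eq_abs_det]
    exact R.toLinearIsometry.normDet_eq_one
  rcases (abs_eq zero_le_one).1 h1 with h | h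
  · exact ⟨R, h, fun v _ => rfl⟩
  · set e : E3 := EuclideanSpace.single 2 1 with he
    have he0 : e ≠ 0 := by
      intro h0
      simpa [he] using congrArg (fun v : E3 => v 2) h0
    have hd : LinearMap.det ((ℝ ∙ e)ᗮ.reflection.toLinearEquiv : E3 →ₗ[ℝ] E3) = -1 := by
      have := Submodule.det_reflection (ℝ ∙ e)ᗮ
      rw [Submodule.orthogonal_orthogonal, finrank_span_singleton he0, pow_one] at this
      exact this
    refine ⟨R.trans (ℝ ∙ e)ᗮ.reflection, ?_, fun v hv => ?_⟩
    · have : ((R.trans (ℝ ∙ e)ᗮ.reflection).toLinearEquiv : E3 →ₗ[ℝ] E3)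
          = ((ℝ ∙ e)ᗮ.reflection.toLinearEquiv : E3 →ₗ[ℝ] E3) ∘ₗ
            (R.toLinearEquiv : E3 →ₗ[ℝ] E3) := rfl
      rw [this, LinearMap.det_comp, hd, h]; norm_num
    · rw [LinearIsometryEquiv.trans_apply]
      apply Submodule.reflection_mem_subspace_eq_self
      rw [Submodule.mem_orthogonal_singleton_iff_inner_right, he, inner_eq]
      simp [hv]

theorem exists_rotation {V₁ V₂ : E3} (h1 : ‖V₁‖ = 1) (h2 : ‖V₂‖ = 1) (hV : V₁ ≠ V₂) :
    ∃ θ : ℝ, 0 < θ ∧ θ ≤ Real.pi / 2 ∧ inner ℝ V₁ V₂ = Real.cos (2 * θ) ∧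
      ∃ R : E3 ≃ₗᵢ[ℝ] E3, LinearMap.det (R.toLinearEquiv : E3 →ₗ[ℝ] E3) = 1 ∧
        R V₁ = equatorPoint θ ∧ R V₂ = equatorPoint (-θ) := by
  have hle : |inner ℝ V₁ V₂| ≤ 1 := by simpa [h1, h2] using abs_real_inner_le_norm V₁ V₂
  have hlt : inner ℝ V₁ V₂ < 1 := lt_of_le_of_ne (abs_le.1 hle).2 fun h =>
    hV ((inner_eq_one_iff_of_norm_eq_one h1 h2).1 h)
  set θ := Real.arccos (inner ℝ V₁ V₂) / 2 with hθ
  have hpos : 0 < θ := half_pos (Real.arccos_pos.2 hlt)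
  have hle2 : θ ≤ Real.pi / 2 := by
    have := Real.arccos_le_pi (inner ℝ V₁ V₂)
    rw [hθ]; linarith
  have hcos : inner ℝ V₁ V₂ = Real.cos (2 * θ) := by
    rw [hθ, mul_div_cancel₀ _ two_ne_zero, Real.cos_arccos (abs_le.1 hle).1 (abs_le.1 hle).2]
  have hs : 0 < Real.sin θ := Real.sin_pos_of_pos_of_lt_pi hpos (by linarith [Real.pi_pos])
  obtain ⟨b, hb1, hb2⟩ := exists_orthonormalBasis_of_norm_eq_one h1 h2 hs
    (Real.cos_sq_add_sin_sq θ) (hcos.trans (Real.cos_two_mul' θ))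
  have e1 : b.repr V₁ = equatorPoint θ := by
    rw [hb1]
    apply ext3 <;> simp [equatorPoint]
  have e2 : b.repr V₂ = equatorPoint (-θ) := by
    rw [hb2]
    apply ext3 <;> simp [equatorPoint]
  obtain ⟨R, hR, hRb⟩ := exists_isometry_det_eq_one b.repr
  refine ⟨θ, hpos, hle2, hcos, R, hR, ?_, ?_⟩
  · rw [hRb V₁ (by rw [e1]; rfl), e1]
  · rw [hRb V₂ (by rw [e2]; rfl), e2]

lemma ne_neg_of_norm_eq_one {V : E3} (h : ‖V‖ = 1) : V ≠ -V := by
  intro h0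
  have h1 : (2 : ℝ) • V = 0 := by
    rw [two_smul]
    nth_rewrite 2 [h0]
    exact add_neg_cancel V
  rw [(smul_eq_zero.1 h1).resolve_left two_ne_zero, norm_zero] at h
  exact zero_ne_one h

lemma directions_of_ne {V₁ V₂ : E3} (h1 : ‖V₁‖ = 1) (h2 : ‖V₂‖ = 1) (hV : V₁ ≠ V₂)
    (hV' : V₂ ≠ -V₁) (f : E3 → ℝ) :
    ∑ V ∈ directions V₁ V₂, f V = f V₁ + (f (-V₁) + (f V₂ + f (-V₂))) := by
  have h3 : V₁ ≠ -V₂ := fun h => hV' (by rw [h, neg_neg])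
  classical
  rw [directions, Finset.sum_insert, Finset.sum_insert, Finset.sum_insert, Finset.sum_singleton]
  · simpa using ne_neg_of_norm_eq_one h2
  · simp only [Finset.mem_insert, Finset.mem_singleton, not_or]
    exact ⟨hV'.symm, fun h => hV (neg_injective h)⟩
  · simp only [Finset.mem_insert, Finset.mem_singleton, not_or]
    exact ⟨ne_neg_of_norm_eq_one h1, hV, h3⟩

lemma directions_neg {V : E3} (h : ‖V‖ = 1) (f : E3 → ℝ) :
    ∑ W ∈ directions V (-V), f W = f V + f (-V) := by
  classical
  have : directions V (-V) = {V, -V} := by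
    ext W; simp only [directions, Finset.mem_insert, Finset.mem_singleton, neg_neg]; tauto
  rw [this, Finset.sum_pair (ne_neg_of_norm_eq_one h)]

lemma log_sq_div_sqrt {x k : ℝ} (hx : x ≠ 0) (hk : 0 < k) :
    Real.log (x ^ 2 / Real.sqrt k) = 2 * Real.log x - Real.log k / 2 := by
  rw [Real.log_div (pow_ne_zero 2 hx) (Real.sqrt_pos.2 hk).ne', Real.log_pow, Real.log_sqrt hk.le]
  norm_num

lemma abs_lt_one_of_one_sub_sq_ne_zero {x : ℝ} (h : |x| ≤ 1) (h0 : 1 - x ^ 2 ≠ 0) : |x| < 1 := by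
  refine lt_of_le_of_ne h fun h1 => h0 ?_
  rw [← sq_abs, h1]; norm_num

/-! ### From the Chern-Ricci function to the curvature. -/

section

variable {M : Type*} [TopologicalSpace M] [ChartedSpace (EuclideanSpace ℝ (Fin 2)) M]

/-- A constant Chern-Ricci function determines the curvature in terms of the normal. -/
theorem exists_curvature_eq {X n : M → E3} (hn : ∀ p, ‖n p‖ = 1)
    (hK : ∀ p, gaussCurvature X n p < 0) {V₁ V₂ : E3} (hV₁ : ‖V₁‖ = 1) (hV₂ : ‖V₂‖ = 1)
    (hV : V₁ ≠ V₂) (hconst : ∃ c : ℝ, ∀ p, (∀ V ∈ directions V₁ V₂, inner ℝ (n p) V < 1) →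
      chernRicci X n V₁ V₂ p = c) :
    ∃ c : ℝ, 0 < c ∧ ∀ p, (1 - inner ℝ (n p) V₁ ^ 2) * (1 - inner ℝ (n p) V₂ ^ 2) ≠ 0 →
      (1 - inner ℝ (n p) V₁ ^ 2) * (1 - inner ℝ (n p) V₂ ^ 2) = c * -gaussCurvature X n p := by
  obtain ⟨c, hc⟩ := hconst
  have hfin : ∀ p, ∀ d : ℝ, (1 - inner ℝ (n p) V₁ ^ 2) * (1 - inner ℝ (n p) V₂ ^ 2) ≠ 0 →
      2 * Real.log ((1 - inner ℝ (n p) V₁ ^ 2) * (1 - inner ℝ (n p) V₂ ^ 2)) -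
        2 * Real.log (-gaussCurvature X n p) = 2 * d →
      (1 - inner ℝ (n p) V₁ ^ 2) * (1 - inner ℝ (n p) V₂ ^ 2)
        = Real.exp d * -gaussCurvature X n p := by
    intro p d h0 hd
    have hle : ∀ V : E3, ‖V‖ = 1 → 0 ≤ 1 - (inner ℝ (n p) V : ℝ) ^ 2 := fun V hV => by
      have h := abs_real_inner_le_norm (n p) V
      rw [hn, hV, mul_one] at h
      rw [sub_nonneg, ← sq_abs]
      exact pow_le_one₀ (abs_nonneg _) h
    have hpos := lt_of_le_of_ne (mul_nonneg (hle V₁ hV₁) (hle V₂ hV₂)) h0.symm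
    have hKp : 0 < -gaussCurvature X n p := neg_pos.2 (hK p)
    have h1 : Real.log ((1 - inner ℝ (n p) V₁ ^ 2) * (1 - inner ℝ (n p) V₂ ^ 2))
        = d + Real.log (-gaussCurvature X n p) := by linarith
    rw [← Real.exp_log hpos, h1, Real.exp_add, Real.exp_log hKp]
  have hlog : ∀ p, (1 - inner ℝ (n p) V₁ ^ 2) * (1 - inner ℝ (n p) V₂ ^ 2) ≠ 0 →
      (∀ V ∈ directions V₁ V₂, inner ℝ (n p) V < 1) ∧ ∀ V, V = V₁ ∨ V = V₂ →
      Real.log ((1 - inner ℝ (n p) V) ^ 2 / Real.sqrt (-gaussCurvature X n p)) +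
        Real.log ((1 - inner ℝ (n p) (-V)) ^ 2 / Real.sqrt (-gaussCurvature X n p))
      = 2 * Real.log (1 - inner ℝ (n p) V ^ 2) - Real.log (-gaussCurvature X n p) := by
    intro p h0
    have habs : ∀ V : E3, V = V₁ ∨ V = V₂ → |(inner ℝ (n p) V : ℝ)| < 1 := by
      rintro V (rfl | rfl)
      · apply abs_lt_one_of_one_sub_sq_ne_zero _ (left_ne_zero_of_mul h0)
        simpa [hn, hV₁] using abs_real_inner_le_norm (n p) V
      · apply abs_lt_one_of_one_sub_sq_ne_zero _ (right_ne_zero_of_mul h0)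
        simpa [hn, hV₂] using abs_real_inner_le_norm (n p) V
    constructor
    · intro V hVd
      simp only [directions, Finset.mem_insert, Finset.mem_singleton] at hVd
      have a1 := abs_lt.1 (habs V₁ (Or.inl rfl))
      have a2 := abs_lt.1 (habs V₂ (Or.inr rfl))
      rcases hVd with rfl | rfl | rfl | rfl
      · exact a1.2
      · rw [inner_neg_right]; linarith [a1.1]
      · exact a2.2
      · rw [inner_neg_right]; linarith [a2.1]
    · intro V hV
      have a := abs_lt.1 (habs V hV)
      have hKp : 0 < -gaussCurvature X n p := neg_pos.2 (hK p)
      have p1 : (1 : ℝ) - inner ℝ (n p) V ≠ 0 := by linarith [a.2]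
      have p2 : (1 : ℝ) + inner ℝ (n p) V ≠ 0 := by linarith [a.1]
      rw [inner_neg_right, sub_neg_eq_add, log_sq_div_sqrt p1 hKp, log_sq_div_sqrt p2 hKp,
        show (1 : ℝ) - inner ℝ (n p) V ^ 2 = (1 - inner ℝ (n p) V) * (1 + inner ℝ (n p) V) by ring,
        Real.log_mul p1 p2]
      ring
  -- For `V₂ = -V₁` the set of directions has only two elements, so the sum is half of the general
  -- expression: the factor is `exp c` instead of `exp (c / 2)`.
  by_cases hV' : V₂ = -V₁
  · refine ⟨Real.exp c, Real.exp_pos _, fun p h0 => hfin p c h0 ?_⟩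
    obtain ⟨hdef, hl⟩ := hlog p h0
    have h := hc p hdef
    rw [chernRicci, hV', directions_neg hV₁, hl V₁ (Or.inl rfl)] at h
    rw [Real.log_mul (left_ne_zero_of_mul h0) (right_ne_zero_of_mul h0), hV', inner_neg_right,
      neg_sq]
    linarith
  · refine ⟨Real.exp (c / 2), Real.exp_pos _, fun p h0 => hfin p (c / 2) h0 ?_⟩
    obtain ⟨hdef, hl⟩ := hlog p h0
    have h := hc p hdef
    rw [chernRicci, directions_of_ne hV₁ hV₂ hV hV', ← add_assoc, hl V₁ (Or.inl rfl),
      hl V₂ (Or.inr rfl)] at h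
    rw [Real.log_mul (left_ne_zero_of_mul h0) (right_ne_zero_of_mul h0)]
    linarith

end

/-! ### Global data, and membership in the model surface. -/

section

variable {M : Type*} [TopologicalSpace M] [ChartedSpace (EuclideanSpace ℝ (Fin 2)) M]
  [IsManifold (𝓡 2) ∞ M] {X n : M → E3}

/-- The local constant is determined at each point by the surface or by its half turn, since at
least one of them has finite Gauss map there; it is therefore locally constant. -/
theorem IsMinimalSurface.exists_hasDataAt [ConnectedSpace M] (hX : IsMinimalSurface X n)
    (hK : ∀ p, gaussCurvature X n p < 0) {θ c : ℝ} (hc : 0 < c)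
    (hC : ∀ p, (1 - inner ℝ (n p) (equatorPoint θ) ^ 2) *
      (1 - inner ℝ (n p) (equatorPoint (-θ)) ^ 2) ≠ 0 →
      (1 - inner ℝ (n p) (equatorPoint θ) ^ 2) * (1 - inner ℝ (n p) (equatorPoint (-θ)) ^ 2)
        = c * -gaussCurvature X n p) :
    ∃ h : ℂ, h ≠ 0 ∧ ∀ p, HasDataAt θ h X n p ∧
      HasDataAt θ h (fun q => halfTurn (X q)) (fun q => halfTurn (n q)) p := by
  have hX' : IsMinimalSurface (fun q => halfTurn (X q)) (fun q => halfTurn (n q)) := by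
    simpa using hX.isometry halfTurn 0
  have hK' : ∀ p, gaussCurvature (fun q => halfTurn (X q)) (fun q => halfTurn (n q)) p
      = gaussCurvature X n p := fun p => by
    simpa using hX.gaussCurvature_isometry halfTurn 0 p
  have hloc : ∀ p, ∃ h : ℂ, h ≠ 0 ∧ ∀ᶠ q in 𝓝 p, HasDataAt θ h X n q ∧
      HasDataAt θ h (fun q => halfTurn (X q)) (fun q => halfTurn (n q)) q := by
    intro p
    by_cases h2 : n p 2 ≠ 1
    · obtain ⟨h, hh, hev⟩ := hX.eventually_hasDataAt hK hc hC h2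
      refine ⟨h, hh, ?_⟩
      filter_upwards [hev] with q ⟨hq, hqd⟩
      refine ⟨hqd, fun hq' => ?_⟩
      rw [halfTurn_two, ne_eq, neg_eq_iff_eq_neg] at hq'
      exact hX.hasDataAt_halfTurn hq hq' hqd (by rwa [halfTurn_two, ne_eq, neg_eq_iff_eq_neg])
    · have h2' : halfTurn (n p) 2 ≠ 1 := by
        rw [not_not] at h2; rw [halfTurn_two, h2]; norm_num
      -- The half turn exchanges the equator points at `θ` and `-θ`, so the curvature relation still
      -- holds.
      obtain ⟨h, hh, hev⟩ := hX'.eventually_hasDataAt (fun p => by rw [hK']; exact hK p) hc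
        (θ := θ) (fun p => by
          rw [hK', inner_halfTurn_equatorPoint, inner_halfTurn_equatorPoint, neg_neg, mul_comm]
          exact hC p) h2'
      refine ⟨h, hh, ?_⟩
      filter_upwards [hev] with q ⟨hq, hqd⟩
      refine ⟨fun hq' => ?_, hqd⟩
      have h3 := hX'.hasDataAt_halfTurn hq
        (by rw [halfTurn_two, ne_eq, neg_inj]; exact hq') hqd
      simp only [halfTurn_halfTurn] at h3
      exact h3 hq'
  choose h hh hev using hloc
  have hconst : IsLocallyConstant h := by
    rw [IsLocallyConstant.iff_eventually_eq]
    intro p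
    filter_upwards [hev p] with q hq
    have hq' := (hev q).self_of_nhds
    by_cases h2 : n q 2 ≠ 1
    · exact hX.hasDataAt_unique h2 hq'.1 hq.1
    · refine hX'.hasDataAt_unique ?_ hq'.2 hq.2
      rw [not_not] at h2; rw [halfTurn_two, h2]; norm_num
  obtain ⟨p₀⟩ : Nonempty M := inferInstance
  refine ⟨h p₀, hh p₀, fun p => ?_⟩
  rw [hconst.apply_eq_of_preconnectedSpace p₀ p]
  exact (hev p).self_of_nhds

omit [IsManifold (𝓡 2) ∞ M] in
lemma HasDataAt.hasScherkData {θ ρ Θ : ℝ} {h : ℂ} (hh : h = ρ * Complex.exp (Complex.I * Θ))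
    (hX : IsMinimalSurface X n) (hd : ∀ p, HasDataAt θ h X n p ∧
      HasDataAt θ h (fun q => halfTurn (X q)) (fun q => halfTurn (n q)) p) :
    HasScherkData θ ρ Θ X n where
  omits p h2 := ((hd p).1 h2).1
  finite p h2 v := by rw [((hd p).1 h2).2, scherkForm_finite, hh]
  infinite p h2 v := by
    have h2' : halfTurn (n p) 2 ≠ 1 := by rwa [halfTurn_two, ne_eq, neg_eq_iff_eq_neg]
    have hinv : invGaussMap n = gaussMap fun q => halfTurn (n q) := by
      ext q
      rw [invGaussMap, gaussMap, halfTurn_zero, halfTurn_one, halfTurn_two]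
      push_cast
      ring
    have h3 := ((hd p).2 h2').2 v
    have h4 := diff_isometry (hX.mdifferentiableAt p) halfTurn 0 v
    simp only [add_zero] at h4
    rw [scherkForm_infinite, hinv, ← hh, ← h3, h4, halfTurn_halfTurn]

omit [IsManifold (𝓡 2) ∞ M] in
-- The data only involve derivatives. This lets the translation be chosen after `ρ` and `Θ`, on
-- which the model surface depends.
lemma IsMinimalSurface.hasDataAt_translate (hX : IsMinimalSurface X n) {R : E3 ≃ₗᵢ[ℝ] E3} {s : E3}
    {θ : ℝ} {h : ℂ} {N : M → E3} {p : M} (t : E3)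
    (hd : HasDataAt θ h (fun q => R (X q) + s) N p ∧
      HasDataAt θ h (fun q => halfTurn (R (X q) + s)) (fun q => halfTurn (N q)) p) :
    HasDataAt θ h (fun q => R (X q) + t) N p ∧
      HasDataAt θ h (fun q => halfTurn (R (X q) + t)) (fun q => halfTurn (N q)) p := by
  have h1 : ∀ t v, diff (fun q => R (X q) + t) p v = R (diff X p v) := fun t v =>
    diff_isometry (hX.mdifferentiableAt p) R t v
  have h2 : ∀ t v, diff (fun q => halfTurn (R (X q) + t)) p v = halfTurn (R (diff X p v)) := by
    intro t v
    simp only [map_add]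
    exact diff_isometry (hX.mdifferentiableAt p) (R.trans halfTurn) (halfTurn t) v
  simpa only [HasDataAt, h1, h2] using hd

/-- If on an open set the surface is obtained by integrating the data along the lift `(α, β)` of
the Gauss map, then near each point the Scherk surface contains either all or none of it. -/
lemma IsMinimalSurface.eventually_mem_scherkSurface (hX : IsMinimalSurface X n) {θ ρ Θ : ℝ}
    {α β : M → ℂ} {p : M} (h : ∀ᶠ q in 𝓝 p, MDifferentiableAt (𝓡 2) 𝓘(ℝ, ℂ) α q ∧
      MDifferentiableAt (𝓡 2) 𝓘(ℝ, ℂ) β q ∧ quartic θ (α q) (β q) ≠ 0 ∧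
      spherePoint (α q) (β q) = n q ∧
      ∀ v, diff X q v = scherkForm θ ρ Θ (α q) (β q) (diff α q v) (diff β q v)) :
    ∃ U ∈ 𝓝 p, ∀ q ∈ U, ∀ q' ∈ U, (X q, n q) ∈ scherkSurface θ ρ Θ →
      (X q', n q') ∈ scherkSurface θ ρ Θ := by
  obtain ⟨s, hso, hsc, hps, hst, hsU, hsp⟩ := exists_chart_ball p h
  refine ⟨_, hsp, ?_⟩
  rintro q ⟨x, hx, rfl⟩ q' ⟨x', hx', rfl⟩ hq
  set ψ := (extChartAt (𝓡 2) p).symm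
  -- Any two points of the convex chart domain are joined by a segment, along which the data are
  -- integrated.
  set γ : ℝ → EuclideanSpace ℝ (Fin 2) := fun t => AffineMap.lineMap x x' t with hγ
  have hγs : ∀ t ∈ Set.Icc (0 : ℝ) 1, γ t ∈ s := fun t ht =>
    hsc.lineMap_mem hx hx' ht
  have hγ0 : γ 0 = x := AffineMap.lineMap_apply_zero _ _
  have hγ1 : γ 1 = x' := AffineMap.lineMap_apply_one _ _
  have hγd : ∀ t, HasDerivAt γ (x' - x) t := fun t => AffineMap.hasDerivAt_lineMap
  have hcomp : ∀ {F : Type} [NormedAddCommGroup F] [NormedSpace ℝ F] (f : M → F) (t : ℝ),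
      t ∈ Set.Icc (0 : ℝ) 1 → MDifferentiableAt (𝓡 2) 𝓘(ℝ, F) f (ψ (γ t)) →
      DifferentiableAt ℝ (f ∘ ψ) (γ t) := by
    intro F _ _ f t ht hf
    have : IsManifold (𝓡 2) 1 M := IsManifold.of_le (n := ∞) (by norm_cast)
    have h1 := mdifferentiableWithinAt_extChartAt_symm (I := 𝓡 2) (hst (hγs t ht))
    rw [ModelWithCorners.range_eq_univ, mdifferentiableWithinAt_univ] at h1
    exact (hf.comp _ h1).differentiableAt
  have hall : ∀ t ∈ Set.Icc (0 : ℝ) 1, ∃ w,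
      HasDerivAt (fun t => X (ψ (γ t))) (diff X (ψ (γ t)) w) t ∧
      HasDerivAt (fun t => α (ψ (γ t))) (diff α (ψ (γ t)) w) t ∧
      HasDerivAt (fun t => β (ψ (γ t))) (diff β (ψ (γ t)) w) t := by
    intro t ht
    obtain ⟨J, hJ, hd⟩ := exists_chart_jacobian p (hst (hγs t ht))
    obtain ⟨dα, dβ, -⟩ := hsU _ (hγs t ht)
    refine ⟨J (x' - x), ?_, ?_, ?_⟩
    · rw [← hd X (hX.mdifferentiableAt _)]
      exact (hcomp X t ht (hX.mdifferentiableAt _)).hasFDerivAt.comp_hasDerivAt t (hγd t)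
    · rw [← hd α dα]
      exact (hcomp α t ht dα).hasFDerivAt.comp_hasDerivAt t (hγd t)
    · rw [← hd β dβ]
      exact (hcomp β t ht dβ).hasFDerivAt.comp_hasDerivAt t (hγd t)
  have hsphere : ∀ t ∈ Set.Icc (0 : ℝ) 1,
      spherePoint (α (ψ (γ t))) (β (ψ (γ t))) = n (ψ (γ t)) := fun t ht =>
    (hsU _ (hγs t ht)).2.2.2.1
  have hs0 := hsphere 0 (by simp)
  have hs1 := hsphere 1 (by simp)
  rw [hγ0] at hs0
  rw [hγ1] at hs1
  have hext := scherkSurface_extend (θ := θ) (ρ := ρ) (Θ := Θ) (a := fun t => α (ψ (γ t)))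
    (b := fun t => β (ψ (γ t))) (y := fun t => X (ψ (γ t)))
    (fun t ht => (hall t ht).choose_spec.2.1.continuousAt.continuousWithinAt)
    (fun t ht => (hall t ht).choose_spec.2.2.continuousAt.continuousWithinAt)
    (fun t ht => (hall t ht).choose_spec.1.continuousAt.continuousWithinAt)
    (fun t ht => (hsU _ (hγs t ht)).2.2.1)
    (fun t ht => by
      obtain ⟨w, w1, w2, w3⟩ := hall t (Set.Ioo_subset_Icc_self ht)
      refine ⟨w2.differentiableAt, w3.differentiableAt, ?_⟩
      rw [w2.deriv, w3.deriv]
      have := (hsU _ (hγs t (Set.Ioo_subset_Icc_self ht))).2.2.2.2 w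
      rw [← this]
      exact w1)
    (by
      simp only [hγ0, hs0]
      exact hq)
  simpa only [hγ1, hs1] using hext

theorem IsMinimalSurface.mem_scherkSurface [ConnectedSpace M] (hX : IsMinimalSurface X n)
    {θ ρ Θ : ℝ} {h : ℂ} (hh : h = ρ * Complex.exp (Complex.I * Θ))
    (hd : ∀ p, HasDataAt θ h X n p ∧
      HasDataAt θ h (fun q => halfTurn (X q)) (fun q => halfTurn (n q)) p)
    {p₀ : M} (hp₀ : (X p₀, n p₀) ∈ scherkSurface θ ρ Θ) (p : M) :
    (X p, n p) ∈ scherkSurface θ ρ Θ := by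
  have hX' : IsMinimalSurface (fun q => halfTurn (X q)) (fun q => halfTurn (n q)) := by
    simpa using hX.isometry halfTurn 0
  have hconst : ∀ (c : ℂ) (q : M) v, diff (fun _ : M => c) q v = 0 := by
    intro c q v
    rw [diff, mfderiv_const]; rfl
  have hloc : ∀ p, ∃ U ∈ 𝓝 p, ∀ q ∈ U, ∀ q' ∈ U, (X q, n q) ∈ scherkSurface θ ρ Θ →
      (X q', n q') ∈ scherkSurface θ ρ Θ := by
    intro p
    by_cases h2 : n p 2 ≠ 1
    · apply hX.eventually_mem_scherkSurface (α := gaussMap n) (β := fun _ => 1)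
      filter_upwards [hX.eventually_ne h2] with q hq
      refine ⟨hX.mdifferentiableAt_gaussMap hq, mdifferentiableAt_const, ((hd q).1 hq).1,
        spherePoint_stereo (hX.norm_normal q) hq, fun v => ?_⟩
      rw [((hd q).1 hq).2, hconst, scherkForm_finite, hh]
    · have h2' : halfTurn (n p) 2 ≠ 1 := by
        rw [not_not] at h2; rw [halfTurn_two, h2]; norm_num
      apply hX.eventually_mem_scherkSurface (α := fun _ => 1)
        (β := gaussMap fun q => halfTurn (n q))
      filter_upwards [hX'.eventually_ne h2'] with q hq
      refine ⟨mdifferentiableAt_const, hX'.mdifferentiableAt_gaussMap hq, ?_, ?_, fun v => ?_⟩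
      · rw [quartic_swap]; exact ((hd q).2 hq).1
      · have h3 : spherePoint (gaussMap (fun q => halfTurn (n q)) q) 1 = halfTurn (n q) :=
          spherePoint_stereo (hX'.norm_normal q) hq
        rw [spherePoint_swap, h3, halfTurn_halfTurn]
      · have h4 := diff_isometry (hX.mdifferentiableAt q) halfTurn 0 v
        simp only [add_zero] at h4
        rw [hconst, scherkForm_infinite, ← hh, ← ((hd q).2 hq).2, h4, halfTurn_halfTurn]
  have hclopen : IsClopen {p | (X p, n p) ∈ scherkSurface θ ρ Θ} := by
    constructor
    · rw [← isOpen_compl_iff, isOpen_iff_mem_nhds]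
      intro p hp
      obtain ⟨U, hU, h⟩ := hloc p
      filter_upwards [hU] with q hq hqS
      exact hp (h q hq p (mem_of_mem_nhds hU) hqS)
    · rw [isOpen_iff_mem_nhds]
      intro p hp
      obtain ⟨U, hU, h⟩ := hloc p
      filter_upwards [hU] with q hq using h p (mem_of_mem_nhds hU) q hq hp
  exact Set.eq_univ_iff_forall.1 (hclopen.eq_univ ⟨p₀, hp₀⟩) p

end

end Scherk

end

/-! ### The main theorem. -/

theorem mainTheorem2 {M : Type*} [TopologicalSpace M]
    [ChartedSpace (EuclideanSpace ℝ (Fin 2)) M] [IsManifold (𝓡 2) ∞ M] [ConnectedSpace M]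
    (X n : M → Scherk.E3) (hX : Scherk.IsMinimalSurface X n)
    (hK : ∀ p, Scherk.gaussCurvature X n p < 0)
    (V₁ V₂ : Scherk.E3) (hV₁ : ‖V₁‖ = 1) (hV₂ : ‖V₂‖ = 1) (hV : V₁ ≠ V₂)
    (hconst : ∃ c : ℝ, ∀ p, (∀ V ∈ Scherk.directions V₁ V₂, inner ℝ (n p) V < 1) →
      Scherk.chernRicci X n V₁ V₂ p = c) :
    ∃ θ ρ Θ : ℝ, 0 < θ ∧ θ ≤ Real.pi / 2 ∧ inner ℝ V₁ V₂ = Real.cos (2 * θ) ∧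
      0 < ρ ∧ Θ ∈ Set.Icc 0 (2 * Real.pi) ∧
      ∃ (R : Scherk.E3 ≃ₗᵢ[ℝ] Scherk.E3) (t : Scherk.E3),
        LinearMap.det (R.toLinearEquiv : Scherk.E3 →ₗ[ℝ] Scherk.E3) = 1 ∧
        Scherk.HasScherkData θ ρ Θ (fun p => R (X p) + t) (fun p => R (n p)) ∧
        ∀ p, (R (X p) + t, R (n p)) ∈ Scherk.scherkSurface θ ρ Θ := by
  obtain ⟨θ, hθ0, hθ1, hθ, R, hR, hR1, hR2⟩ := Scherk.exists_rotation hV₁ hV₂ hV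
  obtain ⟨c, hc, hC⟩ := Scherk.exists_curvature_eq hX.norm_normal hK hV₁ hV₂ hV hconst
  obtain ⟨h, hh0, hh⟩ :=
    (hX.isometry R 0).exists_hasDataAt
      (fun p => by rw [hX.gaussCurvature_isometry]; exact hK p) hc fun p => by
        rw [hX.gaussCurvature_isometry, ← hR1, ← hR2, R.inner_map_map, R.inner_map_map]
        exact hC p
  -- Polar form of `h`; a negative principal argument is shifted by `2π`.
  obtain ⟨Θ, hΘ, hΘh⟩ : ∃ Θ ∈ Set.Icc (0 : ℝ) (2 * Real.pi),
      h = ‖h‖ * Complex.exp (Complex.I * Θ) := by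
    have h1 := Complex.norm_mul_exp_arg_mul_I h
    rcases le_or_gt 0 h.arg with h0 | h0
    · exact ⟨h.arg, ⟨h0, by linarith [Complex.arg_le_pi h, Real.pi_pos]⟩, by
        rw [mul_comm Complex.I, h1]⟩
    · refine ⟨h.arg + 2 * Real.pi, ⟨by linarith [Complex.neg_pi_lt_arg h, Real.pi_pos],
        by linarith⟩, ?_⟩
      have : Complex.I * ((h.arg + 2 * Real.pi : ℝ) : ℂ)
          = h.arg * Complex.I + 2 * Real.pi * Complex.I := by push_cast; ring
      rw [this, Complex.exp_add, Complex.exp_two_pi_mul_I, mul_one, h1]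
  obtain ⟨p₀⟩ : Nonempty M := inferInstance
  -- A position of the model with the same normal as the rotated surface at `p₀`; the translation
  -- will carry `R (X p₀)` to it.
  obtain ⟨y, hy⟩ : ∃ y : Scherk.E3, (y, R (n p₀)) ∈ Scherk.scherkSurface θ ‖h‖ Θ := by
    have hn : ‖R (n p₀)‖ = 1 := by rw [R.norm_map, hX.norm_normal]
    by_cases h2 : R (n p₀) 2 ≠ 1
    · have := Scherk.exists_mem_scherkSurface ‖h‖ Θ ((hh p₀).1 h2).1
      rwa [show Scherk.gaussMap (fun q => R (n q)) p₀ = Scherk.stereo (R (n p₀)) from rfl,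
        Scherk.spherePoint_stereo hn h2] at this
    · have h2' : Scherk.halfTurn (R (n p₀)) 2 ≠ 1 := by
        rw [not_not] at h2; rw [Scherk.halfTurn_two, h2]; norm_num
      have hQ := ((hh p₀).2 h2').1
      rw [Scherk.quartic_swap] at hQ
      have := Scherk.exists_mem_scherkSurface ‖h‖ Θ hQ
      rwa [Scherk.spherePoint_swap, show Scherk.gaussMap
          (fun q => Scherk.halfTurn (R (n q))) p₀ = Scherk.stereo (Scherk.halfTurn (R (n p₀)))
          from rfl, Scherk.spherePoint_stereo (by rwa [Scherk.halfTurn.norm_map]) h2',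
        Scherk.halfTurn_halfTurn] at this
  have hht := fun p => hX.hasDataAt_translate (y - R (X p₀)) (hh p)
  refine ⟨θ, ‖h‖, Θ, hθ0, hθ1, hθ, norm_pos_iff.2 hh0, hΘ, R, y - R (X p₀), hR,
    Scherk.HasDataAt.hasScherkData hΘh (hX.isometry R _) hht,
    (hX.isometry R _).mem_scherkSurface hΘh hht (p₀ := p₀) ?_⟩
  rwa [add_sub_cancel]
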